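/- For a finite simple undirected graph $G$ and an integer $k\ge 0$, call $(G,k)$ a yes-instance of $d$-Path Vertex Cover if there is a set $S\subseteq V(G)$ with $|S|\le k$ such that $G\setminus S$ contains no path on $d$ vertices as a (not necessarily induced) subgraph. Theorem. $d$-Path Vertex Cover, parameterized by the solution size $k$, admits a kernel with $O(k^4 d^{O(d)})$ vertices and edges. That is, there is an absolute constant $C$ such that for every $d\ge 1$ there is an algorithm which, given a graph $G$ and an integer $k\ge 0$, runs in time polynomial in the size of $G$ plus $k$ (where the polynomial may depend on $d$) and outputs a graph $G'$ and an integer $0\le k'\le k$ such that $(G',k')$ is a yes-instance of $d$-Path Vertex Cover if and only if $(G,k)$ is, and $G'$ has at most $C\cdot\max(k,1)^4\cdot d^{Cd}$ vertices and at most $C\cdot\max(k,1)^4\cdot d^{Cd}$ edges. -/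

import Mathlib

/-! ### Path vertex covers -/

/-- `(G, k)` is a yes-instance of `d`-Path Vertex Cover: deleting some set `S` of at most `k`
vertices leaves a graph without a (not necessarily induced) path on `d` vertices as a subgraph. -/
def HasPathVertexCover (d : ℕ) {n : ℕ} (G : SimpleGraph (Fin n)) (k : ℕ) : Prop :=
  ∃ S : Finset (Fin n), S.card ≤ k ∧
    (SimpleGraph.pathGraph d).Free (G.induce {v : Fin n | v ∉ S})

/-! ### A machine model with a step count

Programs of a WHILE language over binary trees with atom `nil`. A program transforms one tree (its
whole store) into another. Every primitive instruction is charged the size of the whole store,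
every control construct one more unit, so the cost of a run bounds the size of every tree that is
built in it, and cost is polynomially related to the running time of a Turing machine. -/

/-- Binary trees, the data that programs work on. -/
inductive Data : Type
  | nil : Data
  | cons : Data → Data → Data
  deriving DecidableEq

namespace Data

/-- The number of nodes of a tree. -/
def size : Data → ℕ
  | nil => 1
  | cons a b => a.size + b.size + 1

/-- The left part of a tree (`nil` for `nil`). -/
def head : Data → Data
  | nil => nil
  | cons a _ => a

/-- The right part of a tree (`nil` for `nil`). -/
def tail : Data → Data
  | nil => nil
  | cons _ b => b

/-- A list of trees as a tree. -/
def ofList : List Data → Data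
  | [] => nil
  | a :: l => cons a (ofList l)

/-- Truth values: `nil` is false, the tree `cons nil nil` is true. -/
def ofBool : Bool → Data
  | false => nil
  | true => cons nil nil

/-- Natural numbers in unary. -/
def ofNat (k : ℕ) : Data := ofList (List.replicate k nil)

open Classical in
/-- The instance `(G, k)` as a tree: the list of the rows of the adjacency matrix of `G`, and `k`
in unary. Its size is a polynomial in the number of vertices plus a linear function of `k`. -/
noncomputable def ofInstance {n : ℕ} (G : SimpleGraph (Fin n)) (k : ℕ) : Data :=
  cons
    (ofList (List.ofFn fun i : Fin n => ofList (List.ofFn fun j : Fin n => ofBool (decide (G.Adj i j)))))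
    (ofNat k)

end Data

/-- Programs. -/
inductive Prog : Type
  /-- leave the store as it is -/
  | id : Prog
  /-- return the constant `nil` -/
  | nil : Prog
  /-- return the left part of the store -/
  | head : Prog
  /-- return the right part of the store -/
  | tail : Prog
  /-- run both programs on the store and pair their results -/
  | cons : Prog → Prog → Prog
  /-- run both programs on the store and test whether their results are equal -/
  | eq : Prog → Prog → Prog
  /-- run the first program, then the second one on its result -/
  | seq : Prog → Prog → Prog
  /-- `ite c p q`: if `c` returns something other than `nil`, run `p`, otherwise run `q` -/
  | ite : Prog → Prog → Prog → Prog
  /-- `while c p`: as long as `c` returns something other than `nil`, replace the store by the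
  result of `p` -/
  | while : Prog → Prog → Prog

/-- `Runs p x y t`: started on the tree `x`, the program `p` halts with result `y` at cost `t`. -/
inductive Runs : Prog → Data → Data → ℕ → Prop
  | id (x : Data) : Runs Prog.id x x x.size
  | nil (x : Data) : Runs Prog.nil x Data.nil x.size
  | head (x : Data) : Runs Prog.head x x.head x.size
  | tail (x : Data) : Runs Prog.tail x x.tail x.size
  | cons {p q : Prog} {x y z : Data} {s t : ℕ} :
      Runs p x y s → Runs q x z t → Runs (Prog.cons p q) x (Data.cons y z) (s + t + 1)
  | eq {p q : Prog} {x y z : Data} {s t : ℕ} :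
      Runs p x y s → Runs q x z t → Runs (Prog.eq p q) x (Data.ofBool (decide (y = z))) (s + t + 1)
  | seq {p q : Prog} {x y z : Data} {s t : ℕ} :
      Runs p x y s → Runs q y z t → Runs (Prog.seq p q) x z (s + t + 1)
  | ite_true {c p q : Prog} {x b y : Data} {s t : ℕ} :
      Runs c x b s → b ≠ Data.nil → Runs p x y t → Runs (Prog.ite c p q) x y (s + t + 1)
  | ite_false {c p q : Prog} {x y : Data} {s t : ℕ} :
      Runs c x Data.nil s → Runs q x y t → Runs (Prog.ite c p q) x y (s + t + 1)
  | while_done {c p : Prog} {x : Data} {s : ℕ} :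
      Runs c x Data.nil s → Runs (Prog.while c p) x x (s + 1)
  | while_step {c p : Prog} {x b y z : Data} {s t r : ℕ} :
      Runs c x b s → b ≠ Data.nil → Runs p x y t → Runs (Prog.while c p) y z r →
      Runs (Prog.while c p) x z (s + t + r + 1)

/-! ### Kernels -/

/-- The parameterized graph problem `Q` (with the set of its yes-instances `(G, k)`, parameter `k`)
admits a kernel with at most `v k` vertices and at most `e k` edges: some program, in time
polynomial in the size of its input `(G, k)`, returns an equivalent instance `(G', k')` of the same
problem with `k' ≤ k` and with at most `v k` vertices and at most `e k` edges. -/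
def AdmitsKernel (Q : ∀ n : ℕ, SimpleGraph (Fin n) → ℕ → Prop) (v e : ℕ → ℕ) : Prop :=
  ∃ (p : Prog) (q : Polynomial ℕ), ∀ (n : ℕ) (G : SimpleGraph (Fin n)) (k : ℕ),
    ∃ (n' : ℕ) (G' : SimpleGraph (Fin n')) (k' t : ℕ),
      Runs p (Data.ofInstance G k) (Data.ofInstance G' k') t ∧
      t ≤ q.eval (Data.ofInstance G k).size ∧
      (Q n' G' k' ↔ Q n G k) ∧
      k' ≤ k ∧ n' ≤ v k ∧ G'.edgeSet.ncard ≤ e k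

/-! ### Polynomial-time functions -/

/-! Pack vertex-disjoint paths on `d` vertices greedily. More than `k` of them make a no-instance.
Otherwise their vertices form a set `M` of at most `dk` vertices, and the rest `F` has no path on
`d` vertices. Hence each branch of a depth first search forest of `F` has fewer than `d` vertices,
and adjacent vertices of `F` lie on a common branch.

A path splits into stretches in `F` that start and end at vertices of `M` or at the ends of the
path. For each pair of such ends and each length, `k + 2d` disjoint segments of `F` are kept if that
many are packed; then one of them avoids a solution and the rest of the path. The closure of these
segments under ancestors is `C`, of size `O(k^3)` for fixed `d`. The vertices of `F` outside `C`
fall into groups by their set `c` of ancestors in `C`. A group is adjacent only to itself, `M` and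
`c`, and a nonempty `c` is the branch of a vertex of `C`, so at most `|C|` groups matter.

In a group, a stretch with both ends in `M` (or absent) is replaced by a packed segment. The others
have an end in `c`, which leaves `O(k)` pairs of ends for fixed `d`. For these a representative
family suffices, because a minimum solution has at most `|c| ≤ d` vertices in the group: otherwise
`c` could be deleted instead (`exchange`). So only `d` vertices of the solution and fewer than `d`
of the path must be avoided, and families of size `d^O(d)` do. This gives `k^3 · k · d^O(d)`
vertices. Edges from `M` to the vertices outside `C` are kept only for marked pairs, and edges
inside `F` join a vertex to one of its at most `d` ancestors, so the edges obey the same bound.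

Correctness is `hasCover_kernel_iff`, resting on `exists_path_of_replace`, `exchange` and
`cover_of_kernel_cover`; the size bound is `kernel_size_le`. The running time is obtained by showing
that polynomial-time functions are closed under composition and bounded folds, with `d` fixed. -/

theorem Polynomial.eval_nat_mono (q : Polynomial ℕ) : Monotone fun n : ℕ => q.eval n := by
  intro a b hab
  induction q using Polynomial.induction_on' with
  | add p q hp hq => simpa only [Polynomial.eval_add] using add_le_add hp hq
  | monomial n c => simpa only [Polynomial.eval_monomial] using
      Nat.mul_le_mul_left c (Nat.pow_le_pow_left hab n)

theorem Data.size_pos (x : Data) : 1 ≤ x.size := by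
  cases x <;> simp [Data.size]

theorem Runs.size_input_le {p : Prog} {x y : Data} {t : ℕ} (h : Runs p x y t) : x.size ≤ t := by
  induction h <;> omega

theorem Runs.size_output_le {p : Prog} {x y : Data} {t : ℕ} (h : Runs p x y t) : y.size ≤ t := by
  induction h with
  | id x => exact le_rfl
  | nil x => exact x.size_pos
  | head x => cases x <;> simp only [Data.size, Data.head] <;> omega
  | tail x => cases x <;> simp only [Data.size, Data.tail] <;> omega
  | cons _ _ h1 h2 => simp only [Data.size]; omega
  | @eq _ _ _ y z _ _ _ _ h1 h2 =>
    have := y.size_pos; have := z.size_pos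
    cases decide (y = z) <;> simp only [Data.ofBool, Data.size] <;> omega
  | while_done h _ => have := h.size_input_le; omega
  | _ => omega

/-- Types whose elements are represented by trees. -/
class Enc (α : Type) where
  enc : α → Data
  enc_injective : Function.Injective enc

open Enc

theorem Data.ofList_injective : Function.Injective Data.ofList := by
  intro a
  induction a with
  | nil => intro b h; cases b with
    | nil => rfl
    | cons => cases h
  | cons x a ih => intro b h; cases b with
    | nil => cases h
    | cons y b =>
      simp only [Data.ofList, Data.cons.injEq] at h
      rw [h.1, ih h.2]

instance : Enc Bool where
  enc := Data.ofBool
  enc_injective := by intro a b; cases a <;> cases b <;> simp [Data.ofBool]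

instance : Enc Unit where
  enc _ := Data.nil
  enc_injective _ _ _ := rfl

instance : Enc ℕ where
  enc := Data.ofNat
  enc_injective := Data.ofList_injective.comp (List.replicate_left_injective _)

instance {α : Type} [Enc α] : Enc (List α) where
  enc l := Data.ofList (l.map enc)
  enc_injective := Data.ofList_injective.comp (List.map_injective_iff.2 enc_injective)

instance {α β : Type} [Enc α] [Enc β] : Enc (α × β) where
  enc x := Data.cons (enc x.1) (enc x.2)
  enc_injective := by
    rintro ⟨a, b⟩ ⟨c, d⟩ h
    simp only [Data.cons.injEq] at h
    rw [enc_injective h.1, enc_injective h.2]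

instance {α : Type} [Enc α] : Enc (Option α) where
  enc x := enc x.toList
  enc_injective := by
    intro x y h
    have := enc_injective h
    cases x <;> cases y <;> simp_all

/-- The size of the representation. -/
def esize {α : Type} [Enc α] (a : α) : ℕ := (enc a).size

theorem esize_pair {α β : Type} [Enc α] [Enc β] (a : α) (b : β) :
    esize (a, b) = esize a + esize b + 1 := rfl

theorem esize_nil {α : Type} [Enc α] : esize ([] : List α) = 1 := rfl

theorem esize_cons {α : Type} [Enc α] (a : α) (l : List α) :
    esize (a :: l) = esize a + esize l + 1 := rfl

theorem esize_pos {α : Type} [Enc α] (a : α) : 1 ≤ esize a := Data.size_pos _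

theorem esize_append {α : Type} [Enc α] (l₁ l₂ : List α) :
    esize (l₁ ++ l₂) + 1 = esize l₁ + esize l₂ := by
  induction l₁ with
  | nil => simp only [List.nil_append, esize_nil]; omega
  | cons a l ih => simp only [List.cons_append, esize_cons]; omega

theorem length_lt_esize {α : Type} [Enc α] (l : List α) : l.length < esize l := by
  induction l with
  | nil => exact Nat.one_pos
  | cons a l ih => rw [List.length_cons, esize_cons]; have := esize_pos a; omega

theorem esize_le_of_mem {α : Type} [Enc α] {a : α} {l : List α} (h : a ∈ l) :
    esize a ≤ esize l := by
  induction l with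
  | nil => cases h
  | cons b l ih =>
    rw [esize_cons]
    rcases List.mem_cons.1 h with rfl | h
    · omega
    · have := ih h; omega

/-- `f` is computed by a program in polynomial time. -/
@[fun_prop]
def PolyTime {α β : Type} [Enc α] [Enc β] (f : α → β) : Prop :=
  ∃ (p : Prog) (q : Polynomial ℕ), ∀ a, ∃ t, Runs p (enc a) (enc (f a)) t ∧ t ≤ q.eval (esize a)

namespace PolyTime

section
variable {α β γ δ Γ σ : Type} [Enc α] [Enc β] [Enc γ] [Enc δ] [Enc Γ] [Enc σ]

theorem esize_le {f : α → β} (hf : PolyTime f) :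
    ∃ q : Polynomial ℕ, ∀ a, esize (f a) ≤ q.eval (esize a) := by
  obtain ⟨p, q, h⟩ := hf
  refine ⟨q, fun a => ?_⟩
  obtain ⟨t, h1, h2⟩ := h a
  exact h1.size_output_le.trans h2

/-- A function that does not change the representation. -/
theorem of_enc_eq {f : α → β} (h : ∀ a, enc (f a) = enc a) : PolyTime f :=
  ⟨Prog.id, Polynomial.X, fun a => ⟨_, by rw [h]; exact Runs.id _, by simp [esize]⟩⟩

@[fun_prop]
theorem id' : PolyTime fun a : α => a := of_enc_eq fun _ => rfl

@[fun_prop]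
theorem comp' {f : β → γ} {g : α → β} (hf : PolyTime f) (hg : PolyTime g) :
    PolyTime fun a => f (g a) := by
  obtain ⟨pf, qf, hf⟩ := hf
  obtain ⟨pg, qg, hg⟩ := hg
  refine ⟨Prog.seq pg pf, qg + qf.comp qg + 1, fun a => ?_⟩
  obtain ⟨t, h1, h2⟩ := hg a
  obtain ⟨s, h3, h4⟩ := hf (g a)
  refine ⟨_, Runs.seq h1 h3, ?_⟩
  have := qf.eval_nat_mono (h1.size_output_le.trans h2)
  simp only [Polynomial.eval_add, Polynomial.eval_comp, Polynomial.eval_one]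
  simp only [esize] at *
  omega

theorem exists_const (d : Data) : ∃ p : Prog, ∃ q : Polynomial ℕ, ∀ x : Data,
    ∃ t, Runs p x d t ∧ t ≤ q.eval x.size := by
  induction d with
  | nil => exact ⟨Prog.nil, Polynomial.X, fun x => ⟨_, Runs.nil x, by simp⟩⟩
  | cons a b iha ihb =>
    obtain ⟨p, q, h⟩ := iha
    obtain ⟨p', q', h'⟩ := ihb
    refine ⟨Prog.cons p p', q + q' + 1, fun x => ?_⟩
    obtain ⟨t, h1, h2⟩ := h x
    obtain ⟨s, h3, h4⟩ := h' x
    refine ⟨_, Runs.cons h1 h3, ?_⟩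
    simp only [Polynomial.eval_add, Polynomial.eval_one]
    omega

@[fun_prop]
theorem const' (b : β) : PolyTime fun _ : α => b := by
  obtain ⟨p, q, h⟩ := exists_const (enc b)
  exact ⟨p, q, fun a => h (enc a)⟩

theorem of_prim {f : α → β} (p : Prog) (h : ∀ a, Runs p (enc a) (enc (f a)) (esize a)) :
    PolyTime f :=
  ⟨p, Polynomial.X, fun a => ⟨_, h a, by simp⟩⟩

theorem fst' : PolyTime (Prod.fst : α × β → α) := of_prim Prog.head fun a => Runs.head (enc a)
theorem snd' : PolyTime (Prod.snd : α × β → β) := of_prim Prog.tail fun a => Runs.tail (enc a)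

@[fun_prop]
theorem fst {f : γ → α × β} (hf : PolyTime f) : PolyTime fun x => (f x).1 := comp' fst' hf

@[fun_prop]
theorem snd {f : γ → α × β} (hf : PolyTime f) : PolyTime fun x => (f x).2 := comp' snd' hf

/-- Pairs the results of two programs. -/
theorem of_cons {f : γ → α} {g : γ → β} {h : γ → δ} (hf : PolyTime f) (hg : PolyTime g)
    (hh : ∀ x, enc (h x) = Data.cons (enc (f x)) (enc (g x))) : PolyTime h := by
  obtain ⟨pf, qf, hf⟩ := hf
  obtain ⟨pg, qg, hg⟩ := hg
  refine ⟨Prog.cons pf pg, qf + qg + 1, fun a => ?_⟩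
  obtain ⟨t, h1, h2⟩ := hf a
  obtain ⟨s, h3, h4⟩ := hg a
  refine ⟨_, hh a ▸ Runs.cons h1 h3, ?_⟩
  simp only [Polynomial.eval_add, Polynomial.eval_one]
  omega

@[fun_prop]
theorem prodMk {f : γ → α} {g : γ → β} (hf : PolyTime f) (hg : PolyTime g) :
    PolyTime fun x => (f x, g x) := of_cons hf hg fun _ => rfl

@[fun_prop]
theorem listCons {f : γ → α} {g : γ → List α} (hf : PolyTime f) (hg : PolyTime g) :
    PolyTime fun x => f x :: g x := of_cons hf hg fun _ => rfl

theorem enc_succ (n : ℕ) : enc (n + 1) = Data.cons Data.nil (enc n) := rfl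

@[fun_prop]
theorem succ {f : γ → ℕ} (hf : PolyTime f) : PolyTime fun x => f x + 1 :=
  of_cons (const' ()) hf fun x => enc_succ (f x)

@[fun_prop]
theorem listTail {f : γ → List α} (hf : PolyTime f) : PolyTime fun x => (f x).tail :=
  comp' (of_prim (f := List.tail) Prog.tail fun a => by
    have := Runs.tail (enc a)
    cases a <;> exact this) hf

@[fun_prop]
theorem pred {f : γ → ℕ} (hf : PolyTime f) : PolyTime fun x => (f x).pred :=
  comp' (of_prim (f := Nat.pred) Prog.tail fun a => by
    have := Runs.tail (enc a)
    cases a <;> exact this) hf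

@[fun_prop]
theorem optionToList {f : γ → Option α} (hf : PolyTime f) : PolyTime fun x => (f x).toList :=
  comp' (of_enc_eq fun _ => rfl) hf

@[fun_prop]
theorem some {f : γ → α} (hf : PolyTime f) : PolyTime fun x => Option.some (f x) :=
  of_cons hf (const' ([] : List α)) fun _ => rfl

-- A number and a list of units have the same tree, so a loop that runs `n` times is a fold over
-- `List.replicate n ()`.
@[fun_prop]
theorem replicateUnit {f : γ → ℕ} (hf : PolyTime f) :
    PolyTime fun x => List.replicate (f x) () :=
  comp' (f := fun n => List.replicate n ()) (of_enc_eq fun n => by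
    change Data.ofList ((List.replicate n ()).map enc) = _
    rw [List.map_replicate]; rfl) hf

@[fun_prop]
theorem decideEq [DecidableEq β] {f g : α → β} (hf : PolyTime f) (hg : PolyTime g) :
    PolyTime fun x => decide (f x = g x) := by
  obtain ⟨pf, qf, hf⟩ := hf
  obtain ⟨pg, qg, hg⟩ := hg
  refine ⟨Prog.eq pf pg, qf + qg + 1, fun a => ?_⟩
  obtain ⟨t, h1, h2⟩ := hf a
  obtain ⟨s, h3, h4⟩ := hg a
  refine ⟨t + s + 1, ?_, ?_⟩
  · have := Runs.eq h1 h3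
    -- Injectivity of the encoding lets the equality test on trees decide equality of the encoded
    -- values.
    have e : decide (enc (f a) = enc (g a)) = decide (f a = g a) :=
      decide_eq_decide.2 enc_injective.eq_iff
    rwa [e] at this
  simp only [Polynomial.eval_add, Polynomial.eval_one]
  omega

@[fun_prop]
theorem cond {c : α → Bool} {f g : α → β} (hc : PolyTime c) (hf : PolyTime f)
    (hg : PolyTime g) : PolyTime fun x => bif c x then f x else g x := by
  obtain ⟨pc, qc, hc⟩ := hc
  obtain ⟨pf, qf, hf⟩ := hf
  obtain ⟨pg, qg, hg⟩ := hg
  refine ⟨Prog.ite pc pf pg, qc + qf + qg + 1, fun a => ?_⟩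
  obtain ⟨r, h5, h6⟩ := hc a
  obtain ⟨t, h1, h2⟩ := hf a
  obtain ⟨s, h3, h4⟩ := hg a
  simp only [Polynomial.eval_add, Polynomial.eval_one]
  cases h : c a
  · rw [h] at h5
    exact ⟨_, Runs.ite_false h5 h3, by omega⟩
  · rw [h] at h5
    exact ⟨_, Runs.ite_true h5 (by simp [enc, Data.ofBool]) h1, by omega⟩

@[fun_prop]
theorem and {f g : α → Bool} (hf : PolyTime f) (hg : PolyTime g) :
    PolyTime fun x => f x && g x := by
  have : PolyTime fun x => bif f x then g x else false := by fun_prop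
  convert this using 2 with x
  cases f x <;> rfl

@[fun_prop]
theorem or {f g : α → Bool} (hf : PolyTime f) (hg : PolyTime g) :
    PolyTime fun x => f x || g x := by
  have : PolyTime fun x => bif f x then true else g x := by fun_prop
  convert this using 2 with x
  cases f x <;> rfl

@[fun_prop]
theorem not {f : α → Bool} (hf : PolyTime f) : PolyTime fun x => !f x := by
  have : PolyTime fun x => bif f x then false else true := by fun_prop
  convert this using 2 with x
  cases f x <;> rfl

end
end PolyTime

/-! ### Folds over lists, and the list and arithmetic functions built from them -/

namespace PolyTime

section
variable {α β γ δ Γ σ : Type} [Enc α] [Enc β] [Enc γ] [Enc δ] [Enc Γ] [Enc σ]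

/-- The body of the loop that folds over a list; the store is the rest of the list, the
accumulator and the context. -/
def foldBody (p : Prog) : Prog :=
  Prog.cons (Prog.seq Prog.head Prog.tail)
    (Prog.cons
      (Prog.seq
        (Prog.cons (Prog.cons (Prog.seq Prog.tail Prog.tail) (Prog.seq Prog.tail Prog.head))
          (Prog.seq Prog.head Prog.head)) p)
      (Prog.seq Prog.tail Prog.tail))

/-- `B` bounds the store. The term `20 * B` pays for the fixed number of projections and pairings
around `p`, each charged at most the store; `q.eval B` pays for `p`. -/
theorem foldBody_runs {f : Γ → σ → α → σ} {p : Prog} {q : Polynomial ℕ}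
    (h : ∀ a : (Γ × σ) × α, ∃ t, Runs p (enc a) (enc (f a.1.1 a.1.2 a.2)) t ∧
      t ≤ q.eval (esize a)) (x : Γ) (s : σ) (a : α) (l : List α) (B : ℕ)
    (hB : esize (a :: l) + esize s + esize x + 2 ≤ B) :
    ∃ t, Runs (foldBody p) (enc (a :: l, (s, x))) (enc (l, (f x s a, x))) t ∧
      t ≤ q.eval B + 20 * B := by
  obtain ⟨t, h1, h2⟩ := h ((x, s), a)
  have e := Runs.cons (Runs.seq (Runs.head (enc (a :: l, (s, x)))) (Runs.tail (enc (a :: l))))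
    (Runs.cons (Runs.seq (Runs.cons (Runs.cons
      (Runs.seq (Runs.tail (enc (a :: l, (s, x)))) (Runs.tail (enc (s, x))))
      (Runs.seq (Runs.tail (enc (a :: l, (s, x)))) (Runs.head (enc (s, x)))))
      (Runs.seq (Runs.head (enc (a :: l, (s, x)))) (Runs.head (enc (a :: l))))) h1)
      (Runs.seq (Runs.tail (enc (a :: l, (s, x)))) (Runs.tail (enc (s, x)))))
  refine ⟨_, e, ?_⟩
  have e1 : (enc (a :: l, (s, x))).size = esize (a :: l) + (esize s + esize x + 1) + 1 := rfl
  have e2 : (enc (s, x)).size = esize s + esize x + 1 := rfl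
  have e3 : (enc (a :: l)).size = esize (a :: l) := rfl
  have e4 : esize ((x, s), a) = esize x + esize s + 1 + esize a + 1 := rfl
  have e5 := esize_cons a l
  have e6 := esize_pos a
  have e7 := esize_pos l
  have := q.eval_nat_mono (show esize ((x, s), a) ≤ B by omega)
  simp only at this
  rw [e1, e2, e3]
  omega

theorem foldLoop_runs {f : Γ → σ → α → σ} {p : Prog} {q : Polynomial ℕ}
    (h : ∀ a : (Γ × σ) × α, ∃ t, Runs p (enc a) (enc (f a.1.1 a.1.2 a.2)) t ∧
      t ≤ q.eval (esize a)) (x : Γ) (B : ℕ) (l : List α) (s : σ)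
    (hB : ∀ l₁ l₂, l = l₁ ++ l₂ → esize l₂ + esize (l₁.foldl (f x) s) + esize x + 2 ≤ B) :
    ∃ t, Runs (Prog.while Prog.head (foldBody p)) (enc (l, (s, x)))
        (enc (([] : List α), (l.foldl (f x) s, x))) t ∧
      t ≤ (l.length + 1) * (q.eval B + 21 * B + 1) := by
  induction l generalizing s with
  | nil =>
    refine ⟨_, Runs.while_done (Runs.head _), ?_⟩
    have := hB [] [] rfl
    have e : (enc (([] : List α), (s, x))).size
      = esize ([] : List α) + (esize s + esize x + 1) + 1 := rfl
    rw [List.foldl_nil] at this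
    rw [e, List.length_nil]
    omega
  | cons a l ih =>
    have h0 := hB [] (a :: l) rfl
    rw [List.foldl_nil] at h0
    obtain ⟨t, h1, h2⟩ := foldBody_runs h x s a l B h0
    obtain ⟨r, h3, h4⟩ := ih (f x s a) fun l₁ l₂ hl => hB (a :: l₁) l₂ (by rw [hl]; rfl)
    refine ⟨_, Runs.while_step (Runs.head _) (by rintro ⟨⟩) h1 h3, ?_⟩
    have e : (enc (a :: l, (s, x))).size = esize (a :: l) + (esize s + esize x + 1) + 1 := rfl
    rw [e, List.length_cons, Nat.add_mul _ 1]
    omega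

/-- A fold of polynomial-time steps can double its accumulator each time, so a polynomial bound on
the accumulator after every prefix has to be assumed. -/
theorem foldl_of_le {l : Γ → List α} {i : Γ → σ} {f : Γ → σ → α → σ} (hl : PolyTime l)
    (hi : PolyTime i) (hf : PolyTime fun a : (Γ × σ) × α => f a.1.1 a.1.2 a.2)
    (Q : Polynomial ℕ) (hQ : ∀ x l₁ l₂, l x = l₁ ++ l₂ →
      esize (l₁.foldl (f x) (i x)) ≤ Q.eval (esize x)) :
    PolyTime fun x => (l x).foldl (f x) (i x) := by
  obtain ⟨ql, hql⟩ := hl.esize_le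
  obtain ⟨p₀, q₀, h₀⟩ : PolyTime fun x => (l x, (i x, x)) := by fun_prop
  obtain ⟨p, q, h⟩ := hf
  set b : Polynomial ℕ := ql + Q + Polynomial.X + 2 with hb
  refine ⟨Prog.seq p₀ (Prog.seq (Prog.while Prog.head (foldBody p))
    (Prog.seq Prog.tail Prog.head)),
    q₀ + (ql + 1) * (q.comp b + 21 * b + 1) + 10 * b + 10, fun x => ?_⟩
  obtain ⟨t, h1, h2⟩ := h₀ x
  have hB : ∀ l₁ l₂, l x = l₁ ++ l₂ →
      esize l₂ + esize (l₁.foldl (f x) (i x)) + esize x + 2 ≤ b.eval (esize x) := by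
    intro l₁ l₂ e
    have e1 := hQ x l₁ l₂ e
    have e2 := hql x
    have e3 := esize_append l₁ l₂
    have e4 := esize_pos l₁
    rw [← e] at e3
    simp only [hb, Polynomial.eval_add, Polynomial.eval_X, Polynomial.eval_ofNat]
    omega
  obtain ⟨r, h3, h4⟩ := foldLoop_runs h x _ (l x) (i x) hB
  refine ⟨_, Runs.seq h1 (Runs.seq h3 (Runs.seq (Runs.tail _) (Runs.head _))), ?_⟩
  have e1 : (enc (([] : List α), ((l x).foldl (f x) (i x), x))).size =
    esize ([] : List α) + (esize ((l x).foldl (f x) (i x)) + esize x + 1) + 1 := rfl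
  have e2 : (enc (([] : List α), ((l x).foldl (f x) (i x), x))).tail.size =
    esize ((l x).foldl (f x) (i x)) + esize x + 1 := rfl
  have e3 := hB (l x) [] (by simp)
  have e4 : (l x).length + 1 ≤ ql.eval (esize x) + 1 := by
    have := hql x; have := length_lt_esize (l x); omega
  have e5 := Nat.mul_le_mul_right (q.eval (b.eval (esize x)) + 21 * b.eval (esize x) + 1) e4
  rw [e1, e2]
  simp only [Polynomial.eval_add, Polynomial.eval_mul, Polynomial.eval_comp, Polynomial.eval_one,
    Polynomial.eval_ofNat]
  omega

/-- Folding is in polynomial time when every step adds little to the accumulator. -/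
theorem foldl_of_add_le {l : Γ → List α} {i : Γ → σ} {f : Γ → σ → α → σ} (hl : PolyTime l)
    (hi : PolyTime i) (hf : PolyTime fun a : (Γ × σ) × α => f a.1.1 a.1.2 a.2)
    (Q : Polynomial ℕ) (hQ : ∀ x s a, esize (f x s a) ≤ esize s + Q.eval (esize (x, a))) :
    PolyTime fun x => (l x).foldl (f x) (i x) := by
  obtain ⟨ql, hql⟩ := hl.esize_le
  obtain ⟨qi, hqi⟩ := hi.esize_le
  refine foldl_of_le hl hi hf (qi + ql * Q.comp (Polynomial.X + ql + 1)) fun x l₁ l₂ e => ?_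
  have key : ∀ l₁ : List α, l₁ ⊆ l x → ∀ s : σ, esize (l₁.foldl (f x) s) ≤
      esize s + l₁.length * Q.eval (esize x + ql.eval (esize x) + 1) := by
    intro l₁
    induction l₁ with
    | nil => intro _ s; simp
    | cons a l₁ ih =>
      intro hs s
      have h1 := ih (fun b hb => hs (List.mem_cons_of_mem _ hb)) (f x s a)
      have h2 := hQ x s a
      have h3 := (esize_le_of_mem (hs List.mem_cons_self)).trans (hql x)
      have h4 := Q.eval_nat_mono (show esize (x, a) ≤ esize x + ql.eval (esize x) + 1 by
        rw [esize_pair]; omega)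
      simp only at h4
      rw [List.foldl_cons, List.length_cons, Nat.add_mul, one_mul]
      omega
  have h1 := key l₁ (by rw [e]; exact List.subset_append_left _ _) (i x)
  have h2 := hqi x
  have h3 : l₁.length ≤ ql.eval (esize x) := by
    have h4 := congrArg List.length e
    rw [List.length_append] at h4
    have := hql x; have := length_lt_esize (l x); omega
  have h4 := Nat.mul_le_mul_right (Q.eval (esize x + ql.eval (esize x) + 1)) h3
  simp only [Polynomial.eval_add, Polynomial.eval_mul, Polynomial.eval_comp, Polynomial.eval_X,
    Polynomial.eval_one]
  omega

@[fun_prop]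
theorem listReverse {f : γ → List α} (hf : PolyTime f) : PolyTime fun x => (f x).reverse := by
  have : PolyTime fun x => (f x).foldl (fun s a => a :: s) [] :=
    foldl_of_add_le (f := fun _ s a => a :: s) hf (by fun_prop) (by fun_prop)
      (Polynomial.X + 1) fun x s a => by
        simp only [esize_cons, esize_pair, Polynomial.eval_add, Polynomial.eval_X,
          Polynomial.eval_one]
        omega
  simpa using this

@[fun_prop]
theorem listAppend {f g : γ → List α} (hf : PolyTime f) (hg : PolyTime g) :
    PolyTime fun x => f x ++ g x := by
  have : PolyTime fun x => (f x).reverse.foldl (fun s a => a :: s) (g x) :=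
    foldl_of_add_le (f := fun _ s a => a :: s) (by fun_prop) (by fun_prop) (by fun_prop)
      (Polynomial.X + 1) fun x s a => by
        simp only [esize_cons, esize_pair, Polynomial.eval_add, Polynomial.eval_X,
          Polynomial.eval_one]
        omega
  simpa using this

@[fun_prop]
theorem listFlatMap {l : Γ → List α} {f : Γ → α → List β} (hl : PolyTime l)
    (hf : PolyTime fun a : Γ × α => f a.1 a.2) : PolyTime fun x => (l x).flatMap (f x) := by
  obtain ⟨q, hq⟩ := hf.esize_le
  have : PolyTime fun x => (l x).foldl (fun s a => s ++ f x a) [] :=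
    foldl_of_add_le (f := fun x s a => s ++ f x a) hl (by fun_prop)
      (listAppend (by fun_prop) (hf.comp' (g := fun a : (Γ × List β) × α => (a.1.1, a.2))
        (by fun_prop))) q fun x s a => by
        have := hq (x, a)
        have := esize_append s (f x a)
        simp only at *
        omega
  convert this using 2 with x
  suffices ∀ (l : List α) (s : List β),
      s ++ l.flatMap (f x) = l.foldl (fun s a => s ++ f x a) s from this (l x) []
  intro l
  induction l with
  | nil => simp
  | cons a l ih => intro s; rw [List.flatMap_cons, List.foldl_cons, ← ih, List.append_assoc]

@[fun_prop]
theorem listMap {l : Γ → List α} {f : Γ → α → β} (hl : PolyTime l)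
    (hf : PolyTime fun a : Γ × α => f a.1 a.2) : PolyTime fun x => (l x).map (f x) := by
  have : PolyTime fun x => (l x).flatMap fun a => [f x a] := by fun_prop
  convert this using 2 with x
  rw [← List.flatMap_singleton' ((l x).map (f x)), List.flatMap_map]

@[fun_prop]
theorem listFlatten {l : Γ → List (List α)} (hl : PolyTime l) :
    PolyTime fun x => (l x).flatten := by
  have : PolyTime fun x => (l x).flatMap fun a => a := by fun_prop
  simpa [List.flatMap_id'] using this

@[fun_prop]
theorem listFilter {l : Γ → List α} {f : Γ → α → Bool} (hl : PolyTime l)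
    (hf : PolyTime fun a : Γ × α => f a.1 a.2) : PolyTime fun x => (l x).filter (f x) := by
  have : PolyTime fun x => (l x).flatMap fun a => bif f x a then [a] else [] := by fun_prop
  convert this using 2 with x
  induction l x with
  | nil => rfl
  | cons a l ih => rw [List.filter_cons, List.flatMap_cons, ih]; cases f x a <;> simp

@[fun_prop]
theorem listAny {l : Γ → List α} {f : Γ → α → Bool} (hl : PolyTime l)
    (hf : PolyTime fun a : Γ × α => f a.1 a.2) : PolyTime fun x => (l x).any (f x) := by
  have : PolyTime fun x => !decide ((l x).flatMap (fun a => bif f x a then [()] else []) = []) := by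
    fun_prop
  convert this using 2 with x
  induction l x with
  | nil => rfl
  | cons a l ih => rw [List.any_cons, List.flatMap_cons, ih]; cases f x a <;> simp

@[fun_prop]
theorem listAll {l : Γ → List α} {f : Γ → α → Bool} (hl : PolyTime l)
    (hf : PolyTime fun a : Γ × α => f a.1 a.2) : PolyTime fun x => (l x).all (f x) := by
  have : PolyTime fun x => !(l x).any fun a => !f x a := by fun_prop
  convert this using 2 with x
  simp [List.all_eq_not_any_not]

@[fun_prop]
theorem optionAll {l : Γ → Option α} {f : Γ → α → Bool} (hl : PolyTime l)
    (hf : PolyTime fun a : Γ × α => f a.1 a.2) : PolyTime fun x => (l x).all (f x) := by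
  have : PolyTime fun x => (l x).toList.all (f x) := by fun_prop
  convert this using 2 with x
  cases l x <;> simp

@[fun_prop]
theorem decideMem [DecidableEq α] {l : Γ → List α} {a : Γ → α} (hl : PolyTime l)
    (ha : PolyTime a) : PolyTime fun x => decide (a x ∈ l x) := by
  have : PolyTime fun x => (l x).any fun b => decide (a x = b) := by fun_prop
  convert this using 2 with x
  rw [Bool.eq_iff_iff]
  simp

@[fun_prop]
theorem listHead? {f : γ → List α} (hf : PolyTime f) : PolyTime fun x => (f x).head? := by
  have : PolyTime fun x => (f x).reverse.foldl (fun _ a => Option.some a) none :=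
    foldl_of_add_le (f := fun _ _ a => Option.some a) (by fun_prop) (by fun_prop) (by fun_prop)
      (Polynomial.X + 2) fun x s a => by
        have : esize (Option.some a) = esize a + 1 + 1 := rfl
        simp only [this, esize_pair, Polynomial.eval_add, Polynomial.eval_X,
          Polynomial.eval_ofNat]
        omega
  convert this using 2 with x
  cases f x <;> simp

@[fun_prop]
theorem optionGetD {f : γ → Option α} {g : γ → α} (hf : PolyTime f) (hg : PolyTime g) :
    PolyTime fun x => (f x).getD (g x) := by
  have : PolyTime fun x => (f x).toList.foldl (fun _ a => a) (g x) :=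
    foldl_of_add_le (f := fun _ _ a => a) (by fun_prop) (by fun_prop) (by fun_prop)
      Polynomial.X fun x s a => by
        simp only [esize_pair, Polynomial.eval_X]
        omega
  convert this using 2 with x
  cases f x <;> simp

@[fun_prop]
theorem listDrop {f : γ → List α} {g : γ → ℕ} (hf : PolyTime f) (hg : PolyTime g) :
    PolyTime fun x => (f x).drop (g x) := by
  have : PolyTime fun x => (List.replicate (g x) ()).foldl (fun s _ => s.tail) (f x) :=
    foldl_of_add_le (f := fun _ s _ => List.tail s) (by fun_prop) (by fun_prop) (by fun_prop)
      0 fun x s a => by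
        cases s with
        | nil => exact Nat.le_add_right _ _
        | cons b s => rw [List.tail_cons, esize_cons]; omega
  convert this using 2 with x
  generalize g x = n
  induction n generalizing x with
  | zero => simp
  | succ n ih =>
    rw [List.replicate_succ', List.foldl_append, ← ih, List.foldl_cons, List.foldl_nil,
      List.tail_drop]

@[fun_prop]
theorem listGetD {f : γ → List α} {g : γ → ℕ} {h : γ → α} (hf : PolyTime f) (hg : PolyTime g)
    (hh : PolyTime h) : PolyTime fun x => (f x).getD (g x) (h x) := by
  have : PolyTime fun x => ((f x).drop (g x)).head?.getD (h x) := by fun_prop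
  convert this using 2 with x
  rw [List.head?_drop, List.getD_eq_getElem?_getD]

@[fun_prop]
theorem tsub {f g : γ → ℕ} (hf : PolyTime f) (hg : PolyTime g) :
    PolyTime fun x => f x - g x := by
  have : PolyTime fun x => (List.replicate (g x) ()).foldl (fun s _ => s.pred) (f x) :=
    foldl_of_add_le (f := fun _ s _ => Nat.pred s) (by fun_prop) (by fun_prop) (by fun_prop)
      0 fun x s a => by
        cases s with
        | zero => exact Nat.le_add_right _ _
        | succ s =>
          have : esize (s + 1) = 1 + esize s + 1 := rfl
          rw [Nat.pred_succ]; omega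
  convert this using 2 with x
  generalize g x = n
  induction n generalizing x with
  | zero => simp
  | succ n ih =>
    rw [List.replicate_succ', List.foldl_append, ← ih, List.foldl_cons, List.foldl_nil,
      Nat.sub_succ]

@[fun_prop]
theorem decideLE {f g : γ → ℕ} (hf : PolyTime f) (hg : PolyTime g) :
    PolyTime fun x => decide (f x ≤ g x) := by
  have : PolyTime fun x => decide (f x - g x = 0) := by fun_prop
  simpa only [Nat.sub_eq_zero_iff_le] using this

@[fun_prop]
theorem listLength {f : γ → List α} (hf : PolyTime f) : PolyTime fun x => (f x).length := by
  have h : PolyTime fun l : List Unit => l.length := of_enc_eq fun l => by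
    have : l = List.replicate l.length () := List.eq_replicate_length.2 fun _ _ => rfl
    conv_rhs => rw [this]
    change _ = Data.ofList ((List.replicate l.length ()).map enc)
    rw [List.map_replicate]; rfl
  have := h.comp' (g := fun x => (f x).map fun _ => ()) (by fun_prop)
  simpa using this

@[fun_prop]
theorem add {f g : γ → ℕ} (hf : PolyTime f) (hg : PolyTime g) : PolyTime fun x => f x + g x := by
  have : PolyTime fun x => (List.replicate (f x) () ++ List.replicate (g x) ()).length := by
    fun_prop
  simpa using this

theorem esize_nat (n : ℕ) : esize n = 2 * n + 1 := by
  induction n with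
  | zero => rfl
  | succ n ih =>
    have : esize (n + 1) = 1 + esize n + 1 := rfl
    omega

@[fun_prop]
theorem listRange {f : γ → ℕ} (hf : PolyTime f) : PolyTime fun x => List.range (f x) := by
  have key : ∀ n, (List.replicate n ()).foldl (fun s _ => s.length :: s) [] =
      (List.range n).reverse := by
    intro n
    induction n with
    | zero => rfl
    | succ n ih => rw [List.replicate_succ', List.foldl_append, ih, List.range_succ]; simp
  have hs : ∀ n, esize (List.range n).reverse ≤ (2 * n + 2) * n + 1 := by
    intro n
    induction n with
    | zero => exact le_rfl
    | succ n ih =>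
      rw [List.range_succ, List.reverse_append, List.reverse_singleton, List.singleton_append,
        esize_cons, esize_nat]
      nlinarith
  obtain ⟨q, hq⟩ := hf.esize_le
  have : PolyTime fun x => ((List.replicate (f x) ()).foldl (fun s _ => s.length :: s) []).reverse :=
    -- The growth of one step depends on the accumulator and not on the list entry, so the additive
    -- criterion does not apply; the closed form `key` bounds every intermediate accumulator.
    listReverse <| foldl_of_le (f := fun _ s _ => s.length :: s) (by fun_prop) (by fun_prop)
      (by fun_prop) ((2 * q + 2) * q + 1) fun x l₁ l₂ e => by
        have h1 : l₁ = List.replicate l₁.length () :=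
          List.eq_replicate_length.2 fun _ _ => rfl
        have h2 : l₁.length ≤ q.eval (esize x) := by
          have h3 := congrArg List.length e
          rw [List.length_append, List.length_replicate] at h3
          have := hq x
          rw [esize_nat] at this
          omega
        rw [h1, key]
        refine (hs _).trans ?_
        simp only [Polynomial.eval_add, Polynomial.eval_mul, Polynomial.eval_ofNat,
          Polynomial.eval_one]
        gcongr
  simpa [key] using this

end
end PolyTime

/-! ### The kernelization algorithm on lists -/

namespace PathCover

/-- The paths on `j` vertices in the part of the graph `A` on the vertices in `U`. -/
def pathsOf (A : ℕ → ℕ → Bool) (U : List ℕ) : ℕ → List (List ℕ)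
  | 0 => [[]]
  | j + 1 => (pathsOf A U j).flatMap fun p =>
      (U.filter fun v => !decide (v ∈ p) && p.head?.all fun w => A v w).map fun v => v :: p

/-- The paths on at most `j` vertices. -/
def pathsUpTo (A : ℕ → ℕ → Bool) (U : List ℕ) : ℕ → List (List ℕ)
  | 0 => pathsOf A U 0
  | j + 1 => pathsUpTo A U j ++ pathsOf A U (j + 1)

/-- A greedy choice of at most `K` pairwise disjoint members of a family. -/
def pack (K : ℕ) (fam : List (List ℕ)) : List (List ℕ) :=
  fam.foldl (fun acc Q =>
    bif !decide (K ≤ acc.length) && Q.all (fun v => !decide (v ∈ acc.flatten)) then Q :: acc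
    else acc) []

/-- Members of a family that represent it: if some member avoids a set of at most `q` elements,
then so does one of these. -/
def rep : ℕ → List (List ℕ) → List (List ℕ)
  | 0, fam => fam.head?.toList
  | q + 1, fam => fam.head?.toList ++
      fam.head?.toList.flatten.flatMap fun v => rep q (fam.filter fun Q => !decide (v ∈ Q))

/-- Two vertices lie on a common path on at most `d` vertices. -/
def linked (A : ℕ → ℕ → Bool) (d : ℕ) (U : List ℕ) (u v : ℕ) : Bool :=
  (pathsUpTo A U d).any fun p => decide (u ∈ p) && decide (v ∈ p)

/-- The vertices without those in a list. -/
def without (U c : List ℕ) : List ℕ := U.filter fun u => !decide (u ∈ c)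

/-- One step of a depth first search for `v`; `c` is the branch found so far. -/
def ancStep (A : ℕ → ℕ → Bool) (d : ℕ) (U : List ℕ) (v : ℕ) (c : List ℕ) : List ℕ :=
  bif decide (v ∈ c) then c else
    ((without U c).filter fun u =>
      (c.head?.all fun w => A u w) && linked A d (without U c) u v).head?.toList ++ c

/-- The first `i` vertices of the branch from the root to `v` in a depth first search forest. -/
def ancUpTo (A : ℕ → ℕ → Bool) (d : ℕ) (U : List ℕ) (v : ℕ) : ℕ → List ℕ
  | 0 => []
  | i + 1 => ancStep A d U v (ancUpTo A d U v i)

/-- The branch from `v` up to the root in a depth first search forest. -/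
def anc (A : ℕ → ℕ → Bool) (d : ℕ) (U : List ℕ) (v : ℕ) : List ℕ := ancUpTo A d U v d

/-- The paths in `U` on `l` vertices, at most `d`, that can be attached to `a` and `b`. -/
def segments (A : ℕ → ℕ → Bool) (d : ℕ) (U : List ℕ) (a b : Option ℕ) (l : ℕ) :
    List (List ℕ) :=
  (pathsUpTo A U d).filter fun Q => decide (Q.length = l) &&
    (a.all fun x => Q.head?.all fun v => A x v) &&
    (b.all fun y => Q.reverse.head?.all fun v => A v y)

/-- The possible ends in `M` of a segment. -/
def ends (M : List ℕ) : List (Option ℕ) := none :: M.map fun x => some x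

/-- Disjoint segments between any two ends in `M`. -/
def linkers (A : ℕ → ℕ → Bool) (d K : ℕ) (M F : List ℕ) : List ℕ :=
  (ends M).flatMap fun a => (ends M).flatMap fun b => (List.range (d + 1)).flatMap fun l =>
    (pack K (segments A d F a b l)).flatten

/-- The closure of a set of vertices under ancestors. -/
def closeUp (A : ℕ → ℕ → Bool) (d : ℕ) (F H : List ℕ) : List ℕ :=
  H.flatMap fun v => anc A d F v

/-- The vertices whose ancestors in `C` are those in `c`. -/
def group (A : ℕ → ℕ → Bool) (d : ℕ) (F C c : List ℕ) : List ℕ :=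
  F.filter fun v => !decide (v ∈ C) && decide ((anc A d F v).filter (fun u => decide (u ∈ C)) = c)

/-- The pairs of possible ends of a segment in a group. -/
def groupEnds (M c : List ℕ) : List (Option ℕ × Option ℕ) :=
  c.flatMap fun b => (ends M ++ c.map fun x => some x).flatMap fun o => [(o, some b), (some b, o)]

/-- The vertices that represent the segments in a group, and the ends for which they do. -/
def groupMarks (A : ℕ → ℕ → Bool) (d : ℕ) (M F C c : List ℕ) : List (Option ℕ × ℕ) :=
  (groupEnds M c).flatMap fun o => (List.range (d + 1)).flatMap fun l =>
    (rep (2 * d) (segments A d (group A d F C c) o.1 o.2 l)).flatten.flatMap fun v =>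
      [(o.1, v), (o.2, v)]

/-- The marks in all groups. -/
def marks (A : ℕ → ℕ → Bool) (d : ℕ) (M F C : List ℕ) : List (Option ℕ × ℕ) :=
  C.flatMap fun a => groupMarks A d M F C (anc A d F a)

/-- The adjacency of the kernel. -/
def keepAdj (A : ℕ → ℕ → Bool) (M C : List ℕ) (W : List (Option ℕ × ℕ)) (u v : ℕ) : Bool :=
  A u v && (((decide (u ∈ M) || decide (u ∈ C)) && (decide (v ∈ M) || decide (v ∈ C))) ||
    (!decide (u ∈ M) && !decide (v ∈ M)) || W.any (fun w => decide (w = (some u, v))) ||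
    W.any (fun w => decide (w = (some v, u))))

/-- The vertices of the kernel. -/
def keepVerts (n : ℕ) (M C : List ℕ) (W : List (Option ℕ × ℕ)) : List ℕ :=
  (List.range n).filter fun v =>
    decide (v ∈ M) || decide (v ∈ C) || decide (v ∈ W.map fun w => w.2)

/-- The adjacency given by a matrix. -/
def adjOf (T : List (List Bool)) (u v : ℕ) : Bool := (T.getD u []).getD v false

/-- The modulator. -/
def modulator (A : ℕ → ℕ → Bool) (d k n : ℕ) : List ℕ :=
  (pack (k + 1) (pathsOf A (List.range n) d)).flatten

/-- The kept vertices outside of the modulator, up to those in the groups. -/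
def core (A : ℕ → ℕ → Bool) (d k : ℕ) (M F : List ℕ) : List ℕ :=
  closeUp A d F (linkers A d (k + 2 * d) M F)

/-- The adjacency matrix of the kernel for given `M`, `C` and marks `W`. -/
def keepMatrix (A : ℕ → ℕ → Bool) (n : ℕ) (M C : List ℕ) (W : List (Option ℕ × ℕ)) :
    List (List Bool) :=
  (keepVerts n M C W).map fun u => (keepVerts n M C W).map fun v => keepAdj A M C W u v

/-- The adjacency matrix of the kernel for a given modulator. -/
def kernelFor (A : ℕ → ℕ → Bool) (d k n : ℕ) (M : List ℕ) : List (List Bool) :=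
  keepMatrix A n M (core A d k M (without (List.range n) M))
    (marks A d M (without (List.range n) M) (core A d k M (without (List.range n) M)))

/-- The kernelization. The instance `N` is returned if there are more than `k` disjoint paths. -/
def kernelize (d : ℕ) (N : List (List Bool) × ℕ) (I : List (List Bool) × ℕ) :
    List (List Bool) × ℕ :=
  bif decide ((pack (I.2 + 1) (pathsOf (adjOf I.1) (List.range I.1.length) d)).length ≤ I.2) then
    (kernelFor (adjOf I.1) d I.2 I.1.length (modulator (adjOf I.1) d I.2 I.1.length), I.2)
  else N

end PathCover

/-! ### Polynomial running time of the kernelization for fixed `d` -/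

namespace PolyTime
open PathCover

section
variable {Γ : Type} [Enc Γ] {T : Γ → List (List Bool)} {U F H M C c p : Γ → List ℕ}
  {u v m k : Γ → ℕ} {a b : Γ → Option ℕ} {W : Γ → List (Option ℕ × ℕ)}

@[fun_prop]
theorem adjOf (hT : PolyTime T) (hu : PolyTime u) (hv : PolyTime v) :
    PolyTime fun x => adjOf (T x) (u x) (v x) := by
  unfold PathCover.adjOf; fun_prop

@[fun_prop]
theorem pathsOf (hT : PolyTime T) (hU : PolyTime U) (j : ℕ) :
    PolyTime fun x => pathsOf (PathCover.adjOf (T x)) (U x) j := by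
  induction j with
  | zero => exact const' _
  | succ j ih => unfold PathCover.pathsOf; fun_prop

@[fun_prop]
theorem pathsUpTo (hT : PolyTime T) (hU : PolyTime U) (j : ℕ) :
    PolyTime fun x => pathsUpTo (PathCover.adjOf (T x)) (U x) j := by
  induction j with
  | zero => unfold PathCover.pathsUpTo; fun_prop
  | succ j ih => unfold PathCover.pathsUpTo; fun_prop

@[fun_prop]
theorem pack {f : Γ → List (List ℕ)} (hk : PolyTime k) (hf : PolyTime f) :
    PolyTime fun x => pack (k x) (f x) := by
  unfold PathCover.pack
  refine foldl_of_add_le (f := fun x acc Q =>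
    bif !decide (k x ≤ acc.length) && Q.all (fun v => !decide (v ∈ acc.flatten)) then Q :: acc
    else acc) hf (by fun_prop) (by fun_prop) (Polynomial.X + 1) fun x s Q => ?_
  generalize (!decide (k x ≤ s.length) && Q.all (fun v => !decide (v ∈ s.flatten))) = t
  simp only [esize_pair, Polynomial.eval_add, Polynomial.eval_X, Polynomial.eval_one]
  cases t <;> simp only [cond_true, cond_false, esize_cons] <;> omega

@[fun_prop]
theorem rep (q : ℕ) {Γ : Type} [Enc Γ] {f : Γ → List (List ℕ)} (hf : PolyTime f) :
    PolyTime fun x => rep q (f x) := by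
  -- The recursive call is made under a binder, with the branching vertex as additional context,
  -- hence the induction over all context types.
  induction q generalizing Γ with
  | zero => unfold PathCover.rep; fun_prop
  | succ q ih =>
    unfold PathCover.rep
    refine listAppend (by fun_prop) (listFlatMap (by fun_prop) (ih ?_))
    fun_prop

@[fun_prop]
theorem linked (d : ℕ) (hT : PolyTime T) (hU : PolyTime U) (hu : PolyTime u) (hv : PolyTime v) :
    PolyTime fun x => linked (PathCover.adjOf (T x)) d (U x) (u x) (v x) := by
  unfold PathCover.linked; fun_prop

@[fun_prop]
theorem without (hU : PolyTime U) (hc : PolyTime c) :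
    PolyTime fun x => without (U x) (c x) := by
  unfold PathCover.without; fun_prop

@[fun_prop]
theorem ancStep (d : ℕ) (hT : PolyTime T) (hU : PolyTime U) (hv : PolyTime v) (hc : PolyTime c) :
    PolyTime fun x => ancStep (PathCover.adjOf (T x)) d (U x) (v x) (c x) := by
  unfold PathCover.ancStep; fun_prop

@[fun_prop]
theorem ancUpTo (d : ℕ) (hT : PolyTime T) (hU : PolyTime U) (hv : PolyTime v) (i : ℕ) :
    PolyTime fun x => ancUpTo (PathCover.adjOf (T x)) d (U x) (v x) i := by
  induction i with
  | zero => exact const' _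
  | succ i ih => unfold PathCover.ancUpTo; fun_prop

@[fun_prop]
theorem anc (d : ℕ) (hT : PolyTime T) (hU : PolyTime U) (hv : PolyTime v) :
    PolyTime fun x => anc (PathCover.adjOf (T x)) d (U x) (v x) := by
  unfold PathCover.anc; fun_prop

@[fun_prop]
theorem segments (d : ℕ) (hT : PolyTime T) (hU : PolyTime U) (ha : PolyTime a) (hb : PolyTime b)
    (hm : PolyTime m) :
    PolyTime fun x => segments (PathCover.adjOf (T x)) d (U x) (a x) (b x) (m x) := by
  unfold PathCover.segments; fun_prop

@[fun_prop]
theorem ends (hM : PolyTime M) : PolyTime fun x => ends (M x) := by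
  unfold PathCover.ends; fun_prop

@[fun_prop]
theorem linkers (d : ℕ) (hT : PolyTime T) (hk : PolyTime k) (hM : PolyTime M) (hF : PolyTime F) :
    PolyTime fun x => linkers (PathCover.adjOf (T x)) d (k x) (M x) (F x) := by
  unfold PathCover.linkers; fun_prop

@[fun_prop]
theorem closeUp (d : ℕ) (hT : PolyTime T) (hF : PolyTime F) (hH : PolyTime H) :
    PolyTime fun x => closeUp (PathCover.adjOf (T x)) d (F x) (H x) := by
  unfold PathCover.closeUp; fun_prop

@[fun_prop]
theorem group (d : ℕ) (hT : PolyTime T) (hF : PolyTime F) (hC : PolyTime C) (hc : PolyTime c) :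
    PolyTime fun x => group (PathCover.adjOf (T x)) d (F x) (C x) (c x) := by
  unfold PathCover.group; fun_prop

@[fun_prop]
theorem groupEnds (hM : PolyTime M) (hc : PolyTime c) :
    PolyTime fun x => groupEnds (M x) (c x) := by
  unfold PathCover.groupEnds; fun_prop

@[fun_prop]
theorem groupMarks (d : ℕ) (hT : PolyTime T) (hM : PolyTime M) (hF : PolyTime F)
    (hC : PolyTime C) (hc : PolyTime c) :
    PolyTime fun x => groupMarks (PathCover.adjOf (T x)) d (M x) (F x) (C x) (c x) := by
  unfold PathCover.groupMarks; fun_prop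

@[fun_prop]
theorem marks (d : ℕ) (hT : PolyTime T) (hM : PolyTime M) (hF : PolyTime F) (hC : PolyTime C) :
    PolyTime fun x => marks (PathCover.adjOf (T x)) d (M x) (F x) (C x) := by
  unfold PathCover.marks; fun_prop

@[fun_prop]
theorem keepAdj (hT : PolyTime T) (hM : PolyTime M) (hC : PolyTime C) (hW : PolyTime W)
    (hu : PolyTime u) (hv : PolyTime v) :
    PolyTime fun x => keepAdj (PathCover.adjOf (T x)) (M x) (C x) (W x) (u x) (v x) := by
  unfold PathCover.keepAdj; fun_prop

@[fun_prop]
theorem keepVerts (hk : PolyTime k) (hM : PolyTime M) (hC : PolyTime C) (hW : PolyTime W) :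
    PolyTime fun x => keepVerts (k x) (M x) (C x) (W x) := by
  unfold PathCover.keepVerts; fun_prop

@[fun_prop]
theorem modulator (d : ℕ) (hT : PolyTime T) (hk : PolyTime k) (hm : PolyTime m) :
    PolyTime fun x => modulator (PathCover.adjOf (T x)) d (k x) (m x) := by
  unfold PathCover.modulator; fun_prop

@[fun_prop]
theorem core (d : ℕ) (hT : PolyTime T) (hk : PolyTime k) (hM : PolyTime M) (hF : PolyTime F) :
    PolyTime fun x => core (PathCover.adjOf (T x)) d (k x) (M x) (F x) := by
  unfold PathCover.core; fun_prop

@[fun_prop]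
theorem keepMatrix (hT : PolyTime T) (hk : PolyTime k) (hM : PolyTime M) (hC : PolyTime C)
    (hW : PolyTime W) :
    PolyTime fun x => keepMatrix (PathCover.adjOf (T x)) (k x) (M x) (C x) (W x) := by
  have hR := keepVerts hk hM hC hW
  refine listMap hR (listMap (hR.comp' (by fun_prop)) ?_)
  have h : PolyTime fun a : (Γ × ℕ) × ℕ => a.1.1 := by fun_prop
  exact keepAdj (hT.comp' h) (hM.comp' h) (hC.comp' h) (hW.comp' h) (by fun_prop) (by fun_prop)

@[fun_prop]
theorem kernelFor (d : ℕ) (hT : PolyTime T) (hk : PolyTime k) (hm : PolyTime m)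
    (hM : PolyTime M) :
    PolyTime fun x => kernelFor (PathCover.adjOf (T x)) d (k x) (m x) (M x) := by
  unfold PathCover.kernelFor; fun_prop

theorem kernelize (d : ℕ) (N : List (List Bool) × ℕ) : PolyTime (kernelize d N) := by
  unfold PathCover.kernelize; fun_prop

end
end PolyTime

/-! ### Enumerated paths, greedy packings and representative families -/

namespace PathCover

section
variable {A : ℕ → ℕ → Bool} {U : List ℕ}

theorem mem_pathsOf {j : ℕ} {p : List ℕ} : p ∈ pathsOf A U j ↔
    p.length = j ∧ p.Nodup ∧ p.IsChain (fun a b => A a b) ∧ p ⊆ U := by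
  induction j generalizing p with
  | zero =>
    simp only [pathsOf, List.mem_singleton, List.length_eq_zero_iff]
    exact ⟨by rintro rfl; simp, fun h => h.1⟩
  | succ j ih =>
    simp only [pathsOf, List.mem_flatMap, List.mem_map, List.mem_filter, Bool.and_eq_true,
      Bool.not_eq_true', decide_eq_false_iff_not, Option.all_eq_true]
    constructor
    · rintro ⟨p, hp, v, ⟨hv, hvp, hA⟩, rfl⟩
      obtain ⟨h1, h2, h3, h4⟩ := ih.1 hp
      exact ⟨by simp [h1], List.nodup_cons.2 ⟨hvp, h2⟩, List.isChain_cons.2 ⟨hA, h3⟩,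
        List.cons_subset.2 ⟨hv, h4⟩⟩
    · rintro ⟨h1, h2, h3, h4⟩
      cases p with
      | nil => cases h1
      | cons v p =>
        rw [List.nodup_cons] at h2
        rw [List.isChain_cons] at h3
        rw [List.cons_subset] at h4
        exact ⟨p, ih.2 ⟨by simpa using h1, h2.2, h3.2, h4.2⟩, v, ⟨h4.1, h2.1, h3.1⟩, rfl⟩

theorem mem_pathsUpTo {j : ℕ} {p : List ℕ} : p ∈ pathsUpTo A U j ↔
    p.length ≤ j ∧ p.Nodup ∧ p.IsChain (fun a b => A a b) ∧ p ⊆ U := by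
  induction j with
  | zero => simp [pathsUpTo, mem_pathsOf]
  | succ j ih =>
    rw [pathsUpTo, List.mem_append, ih, mem_pathsOf, Nat.le_succ_iff]
    tauto

end

section pack
variable {K : ℕ} {fam : List (List ℕ)}

/-- What the greedy choice guarantees. -/
theorem pack_spec (K : ℕ) (fam : List (List ℕ)) :
    pack K fam ⊆ fam ∧ (pack K fam).length ≤ K ∧ (pack K fam).Pairwise List.Disjoint ∧
      ((pack K fam).length < K → ∀ Q ∈ fam, Q ≠ [] → ∃ v ∈ Q, v ∈ (pack K fam).flatten) := by
  -- The induction needs an arbitrary initial accumulator, onto which the fold prepends the newly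
  -- chosen members.
  suffices h : ∀ fam acc : List (List ℕ), acc.length ≤ K → acc.Pairwise List.Disjoint →
      ∃ new, fam.foldl (fun acc Q =>
        bif !decide (K ≤ acc.length) && Q.all (fun v => !decide (v ∈ acc.flatten)) then Q :: acc
        else acc) acc = new ++ acc ∧ new ⊆ fam ∧ (new ++ acc).length ≤ K ∧
      (new ++ acc).Pairwise List.Disjoint ∧
      ((new ++ acc).length < K → ∀ Q ∈ fam, Q ≠ [] → ∃ v ∈ Q, v ∈ (new ++ acc).flatten) by
    obtain ⟨new, h1, h2, h3, h4, h5⟩ := h fam [] (Nat.zero_le _) List.Pairwise.nil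
    rw [List.append_nil] at *
    rw [pack, h1]
    exact ⟨h2, h3, h4, h5⟩
  intro fam
  induction fam with
  | nil => intro acc h1 h2; exact ⟨[], rfl, by simp, by simpa, by simpa, by simp⟩
  | cons Q fam ih =>
    intro acc h1 h2
    rw [List.foldl_cons]
    cases hc : (!decide (K ≤ acc.length) && Q.all (fun v => !decide (v ∈ acc.flatten)))
    · obtain ⟨new, h3, h4, h5, h6, h7⟩ := ih acc h1 h2
      refine ⟨new, h3, fun R hR => List.mem_cons_of_mem _ (h4 hR), h5, h6, fun hlt R hR hne => ?_⟩
      rcases List.mem_cons.1 hR with rfl | hR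
      · rw [Bool.and_eq_false_iff, Bool.not_eq_false', decide_eq_true_iff,
          List.all_eq_false] at hc
        rcases hc with hc | ⟨v, hv, hv'⟩
        · rw [List.length_append] at hlt; omega
        · refine ⟨v, hv, ?_⟩
          rw [List.flatten_append, List.mem_append]
          exact Or.inr (by simpa using hv')
      · exact h7 hlt R hR hne
    · rw [Bool.and_eq_true, Bool.not_eq_true', decide_eq_false_iff_not, List.all_eq_true] at hc
      have h8 : ∀ R ∈ acc, List.Disjoint Q R := fun R hR v hv hv' => by
        have := hc.2 v hv
        rw [Bool.not_eq_true', decide_eq_false_iff_not] at this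
        exact this (List.mem_flatten.2 ⟨R, hR, hv'⟩)
      obtain ⟨new, h3, h4, h5, h6, h7⟩ := ih (Q :: acc) (by rw [List.length_cons]; omega)
        (List.pairwise_cons.2 ⟨h8, h2⟩)
      have e : new ++ Q :: acc = (new ++ [Q]) ++ acc := by simp
      rw [cond_true]
      rw [e] at h3 h5 h6 h7
      refine ⟨new ++ [Q], h3, ?_, h5, h6, fun hlt R hR hne => ?_⟩
      · intro R hR
        rcases List.mem_append.1 hR with hR | hR
        · exact List.mem_cons_of_mem _ (h4 hR)
        · rw [List.mem_singleton.1 hR]; exact List.mem_cons_self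
      · rcases List.mem_cons.1 hR with rfl | hR
        · obtain ⟨v, l, rfl⟩ := List.exists_cons_of_ne_nil hne
          exact ⟨v, List.mem_cons_self, List.mem_flatten.2 ⟨v :: l, by simp, List.mem_cons_self⟩⟩
        · exact h7 hlt R hR hne

/-- More disjoint lists than a set has elements: one of them avoids the set. -/
theorem exists_disjoint_of_card_lt {l : List (List ℕ)} (hl : l.Pairwise List.Disjoint)
    (Z : Finset ℕ) (hZ : Z.card < l.length) : ∃ Q ∈ l, ∀ v ∈ Q, v ∉ Z := by
  induction l generalizing Z with
  | nil => simp at hZ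
  | cons Q l ih =>
    rw [List.pairwise_cons] at hl
    by_cases h : ∀ v ∈ Q, v ∉ Z
    · exact ⟨Q, List.mem_cons_self, h⟩
    · push Not at h
      obtain ⟨v, hv, hvZ⟩ := h
      obtain ⟨R, hR, hRZ⟩ := ih hl.2 (Z.erase v) (by
        have := Finset.card_erase_lt_of_mem hvZ
        rw [List.length_cons] at hZ
        omega)
      refine ⟨R, List.mem_cons_of_mem _ hR, fun w hw hwZ => hRZ w hw (Finset.mem_erase.2 ⟨?_, hwZ⟩)⟩
      rintro rfl
      exact hl.1 R hR hv hw

end pack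

section rep

theorem rep_subset (q : ℕ) (fam : List (List ℕ)) : rep q fam ⊆ fam := by
  induction q generalizing fam with
  | zero => intro Q hQ; exact List.mem_of_mem_head? (by simpa [rep] using hQ)
  | succ q ih =>
    intro Q hQ
    rw [rep, List.mem_append, List.mem_flatMap] at hQ
    rcases hQ with hQ | ⟨v, _, hQ⟩
    · exact List.mem_of_mem_head? (by simpa using hQ)
    · exact (List.mem_filter.1 (ih _ hQ)).1

/-- Bounded branching: the first member `R` either avoids `Z` or contains some `v ∈ Z`. In the
latter case `Q` survives the restriction to members without `v`, and in there only the smaller set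
`Z.erase v` has to be avoided. -/
theorem rep_spec {q : ℕ} {fam : List (List ℕ)} {Z : Finset ℕ} (hZ : Z.card ≤ q) {Q : List ℕ}
    (hQ : Q ∈ fam) (hQZ : ∀ v ∈ Q, v ∉ Z) : ∃ R ∈ rep q fam, ∀ v ∈ R, v ∉ Z := by
  induction q generalizing fam Z with
  | zero =>
    obtain rfl := Finset.card_eq_zero.1 (Nat.le_zero.1 hZ)
    cases fam with
    | nil => cases hQ
    | cons R fam => exact ⟨R, by simp [rep], by simp⟩
  | succ q ih =>
    cases fam with
    | nil => cases hQ
    | cons R fam =>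
      by_cases h : ∀ v ∈ R, v ∉ Z
      · exact ⟨R, by simp [rep], h⟩
      · push Not at h
        obtain ⟨v, hv, hvZ⟩ := h
        obtain ⟨P, hP, hPZ⟩ := @ih ((R :: fam).filter fun Q => !decide (v ∈ Q)) (Z.erase v) (by
          have := Finset.card_erase_lt_of_mem hvZ
          omega) (List.mem_filter.2 ⟨hQ, by simpa using fun h => hQZ v h hvZ⟩)
          (fun w hw hwZ => hQZ w hw (Finset.mem_of_mem_erase hwZ))
        refine ⟨P, ?_, fun w hw hwZ => hPZ w hw (Finset.mem_erase.2 ⟨?_, hwZ⟩)⟩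
        · rw [rep, List.mem_append, List.mem_flatMap]
          exact Or.inr ⟨v, by simpa using hv, hP⟩
        · rintro rfl
          have := (List.mem_filter.1 (rep_subset _ _ hP)).2
          simp [hw] at this

theorem length_flatMap_le {α β : Type} {l : List α} {f : α → List β} {b : ℕ}
    (h : ∀ a ∈ l, (f a).length ≤ b) : (l.flatMap f).length ≤ l.length * b := by
  induction l with
  | nil => simp
  | cons a l ih =>
    rw [List.flatMap_cons, List.length_append, List.length_cons, Nat.add_mul, one_mul]
    have h1 := h a List.mem_cons_self
    have h2 := ih fun x hx => h x (List.mem_cons_of_mem _ hx)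
    omega

theorem length_flatten_le {α : Type} {l : List (List α)} {b : ℕ}
    (h : ∀ a ∈ l, a.length ≤ b) : l.flatten.length ≤ l.length * b := by
  have := length_flatMap_le (f := fun a : List α => a) h
  simpa [List.flatMap_id'] using this

/-- The recursion is `T (q + 1) ≤ 1 + d * T q`, one call for each vertex of the first member. -/
theorem length_rep_le {d : ℕ} (hd : 1 ≤ d) (q : ℕ) {fam : List (List ℕ)}
    (h : ∀ Q ∈ fam, Q.length ≤ d) : (rep q fam).length ≤ (q + 1) * d ^ q := by
  induction q generalizing fam with
  | zero => cases fam <;> simp [rep]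
  | succ q ih =>
    have h1 : fam.head?.toList.length ≤ 1 := by cases fam <;> simp
    have h2 : fam.head?.toList.flatten.length ≤ d := by
      cases fam with
      | nil => simp
      | cons Q fam => simpa using h Q List.mem_cons_self
    rw [rep, List.length_append]
    have h3 := length_flatMap_le (l := fam.head?.toList.flatten)
      (f := fun v => rep q (fam.filter fun Q => !decide (v ∈ Q))) (b := (q + 1) * d ^ q)
      fun v _ => ih fun Q hQ => h Q (List.mem_filter.1 hQ).1
    have h4 := Nat.mul_le_mul_right ((q + 1) * d ^ q) h2
    have h5 : 1 ≤ d ^ (q + 1) := Nat.one_le_pow _ _ hd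
    have h6 : (q + 1 + 1) * d ^ (q + 1) = d * ((q + 1) * d ^ q) + d ^ (q + 1) := by ring
    omega

end rep

/-! ### Connectivity in graphs without long paths -/

/-- The lists that are paths of `A` with all vertices in `U`. -/
def IsPathIn (A : ℕ → ℕ → Bool) (U : List ℕ) (p : List ℕ) : Prop :=
  p.Nodup ∧ p.IsChain (fun a b => A a b) ∧ p ⊆ U

/-- Two vertices are connected within `U`. -/
def Conn (A : ℕ → ℕ → Bool) (U : List ℕ) : ℕ → ℕ → Prop :=
  Relation.ReflTransGen fun a b => A a b ∧ a ∈ U ∧ b ∈ U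

theorem mem_without {U c : List ℕ} {u : ℕ} : u ∈ without U c ↔ u ∈ U ∧ u ∉ c := by
  simp [without]

section
variable {A : ℕ → ℕ → Bool} {U U' : List ℕ} {d : ℕ} {u v w : ℕ}

theorem Conn.mono (h : U ⊆ U') (hc : Conn A U u v) : Conn A U' u v :=
  hc.lift id fun _ _ hab => ⟨hab.1, h hab.2.1, h hab.2.2⟩

theorem Conn.symm (hA : ∀ a b, A a b → A b a) (hc : Conn A U u v) : Conn A U v u := by
  induction hc with
  | refl => exact Relation.ReflTransGen.refl
  | tail _ hab ih => exact Relation.ReflTransGen.head ⟨hA _ _ hab.1, hab.2.2, hab.2.1⟩ ih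

/-- A walk is turned into a path from its end backwards: a new first vertex that already occurs cuts
off the loop it would close. -/
theorem Conn.exists_path (hc : Conn A U u v) (hv : v ∈ U) :
    ∃ p, IsPathIn A U p ∧ p.head? = some u ∧ p.getLast? = some v := by
  induction hc using Relation.ReflTransGen.head_induction_on with
  | refl => exact ⟨[v], ⟨by simp, by simp, by simpa⟩, rfl, rfl⟩
  | @head a b hab _ ih =>
    obtain ⟨p, ⟨h1, h2, h3⟩, h4, h5⟩ := ih
    by_cases ha : a ∈ p
    · obtain ⟨s, t, rfl⟩ := List.append_of_mem ha
      refine ⟨a :: t, ⟨h1.sublist (List.sublist_append_right _ _),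
        (List.isChain_append.1 h2).2.1, fun x hx => h3 (List.mem_append_right _ hx)⟩, rfl, ?_⟩
      rw [List.getLast?_append] at h5
      cases h6 : (a :: t).getLast? with
      | none => simp at h6
      | some y => rw [h6] at h5; exact h5
    · refine ⟨a :: p, ⟨List.nodup_cons.2 ⟨ha, h1⟩, List.isChain_cons.2 ⟨?_, h2⟩,
        List.cons_subset.2 ⟨hab.2.1, h3⟩⟩, rfl, ?_⟩
      · intro y hy
        rw [h4, Option.mem_some_iff] at hy
        exact hy ▸ hab.1
      · cases p with
        | nil => simp at h4
        | cons x p => rw [List.getLast?_cons_cons]; exact h5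

theorem IsPathIn.conn_head {p : List ℕ} (hp : p.IsChain (fun a b => A a b)) (hU : p ⊆ U)
    (hu : p.head? = some u) (hv : v ∈ p) : Conn A U u v := by
  induction p generalizing u with
  | nil => cases hv
  | cons a p ih =>
    obtain rfl : a = u := by simpa using hu
    rcases List.mem_cons.1 hv with rfl | hv
    · exact Relation.ReflTransGen.refl
    · rw [List.isChain_cons] at hp
      rw [List.cons_subset] at hU
      cases p with
      | nil => cases hv
      | cons b p =>
        exact Relation.ReflTransGen.head ⟨hp.1 b rfl, hU.1, hU.2 List.mem_cons_self⟩
          (ih hp.2 hU.2 rfl hv)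

theorem IsPathIn.conn (hA : ∀ a b, A a b → A b a) {p : List ℕ} (hp : IsPathIn A U p)
    (hu : u ∈ p) (hv : v ∈ p) : Conn A U u v := by
  cases p with
  | nil => cases hu
  | cons a p =>
    exact ((IsPathIn.conn_head hp.2.1 hp.2.2 rfl hu).symm hA).trans
      (IsPathIn.conn_head hp.2.1 hp.2.2 rfl hv)

/-- Without paths on `d` vertices, connected vertices are joined by a path short enough to be
enumerated. This makes the connectivity test of the search computable by `linked`. -/
theorem linked_iff (hA : ∀ a b, A a b → A b a) (hd : ∀ p, IsPathIn A U p → p.length < d) :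
    linked A d U u v ↔ u ∈ U ∧ v ∈ U ∧ Conn A U u v := by
  simp only [linked, List.any_eq_true, Bool.and_eq_true, decide_eq_true_iff, mem_pathsUpTo]
  constructor
  · rintro ⟨p, ⟨_, h⟩, hu, hv⟩
    exact ⟨h.2.2 hu, h.2.2 hv, IsPathIn.conn hA h hu hv⟩
  · rintro ⟨_, hv, h⟩
    obtain ⟨p, h1, h2, h3⟩ := h.exists_path hv
    exact ⟨p, ⟨(hd p h1).le, h1⟩, List.mem_of_mem_head? h2, List.mem_of_getLast? h3⟩

end

/-! ### Depth first search forests -/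

section forest
variable {A : ℕ → ℕ → Bool} {U : List ℕ} {d : ℕ} {u v w : ℕ} {c : List ℕ}

theorem ancStep_of_mem (h : v ∈ c) : ancStep A d U v c = c := by simp [ancStep, h]

theorem ancStep_cases (hA : ∀ a b, A a b → A b a) (hd : ∀ p, IsPathIn A U p → p.length < d)
    (hv : v ∉ c) :
    (ancStep A d U v c = c ∧ ∀ u, u ∈ without U c → v ∈ without U c → Conn A (without U c) u v →
      ¬ ∀ x ∈ c.head?, A u x) ∨
    ∃ u, ancStep A d U v c = u :: c ∧ u ∈ without U c ∧ v ∈ without U c ∧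
      Conn A (without U c) u v ∧ ∀ x ∈ c.head?, A u x := by
  have hd' : ∀ p, IsPathIn A (without U c) p → p.length < d := fun p hp =>
    hd p ⟨hp.1, hp.2.1, fun x hx => (mem_without.1 (hp.2.2 hx)).1⟩
  rw [ancStep, decide_eq_false hv, cond_false]
  cases h : (List.filter (fun u => (Option.all (fun w => A u w) c.head?) &&
    linked A d (without U c) u v) (without U c)) with
  | nil =>
    left
    refine ⟨rfl, fun u hu hv hc h' => ?_⟩
    rw [List.filter_eq_nil_iff] at h
    refine h u hu ?_
    rw [Bool.and_eq_true, Option.all_eq_true]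
    exact ⟨h', (linked_iff hA hd').2 ⟨hu, hv, hc⟩⟩
  | cons u l =>
    right
    have hu : u ∈ List.filter (fun u => (Option.all (fun w => A u w) c.head?) &&
      linked A d (without U c) u v) (without U c) := by rw [h]; exact List.mem_cons_self
    rw [List.mem_filter, Bool.and_eq_true, linked_iff hA hd', Option.all_eq_true] at hu
    exact ⟨u, rfl, hu.1, hu.2.2.2.1, hu.2.2.2.2, hu.2.1⟩

/-- The next vertex of a branch depends only on the component left after deleting `c`. The
comparison of branches below rests on this. -/
theorem ancStep_congr (hA : ∀ a b, A a b → A b a) (hd : ∀ p, IsPathIn A U p → p.length < d)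
    (hu : u ∈ without U c) (hv : v ∈ without U c) (h : Conn A (without U c) u v) :
    ancStep A d U u c = ancStep A d U v c := by
  have hd' : ∀ p, IsPathIn A (without U c) p → p.length < d := fun p hp =>
    hd p ⟨hp.1, hp.2.1, fun x hx => (mem_without.1 (hp.2.2 hx)).1⟩
  have : ∀ x, linked A d (without U c) x u = linked A d (without U c) x v := by
    intro x
    rw [Bool.eq_iff_iff, linked_iff hA hd', linked_iff hA hd']
    exact ⟨fun hx => ⟨hx.1, hv, hx.2.2.trans h⟩, fun hx => ⟨hx.1, hu, hx.2.2.trans (h.symm hA)⟩⟩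
  simp only [ancStep, (mem_without.1 hu).2, (mem_without.1 hv).2, this]

theorem suffix_ancStep (A : ℕ → ℕ → Bool) (d : ℕ) (U : List ℕ) (v : ℕ) (c : List ℕ) :
    c <:+ ancStep A d U v c := by
  rw [ancStep]
  cases decide (v ∈ c)
  · exact List.suffix_append _ _
  · exact List.suffix_rfl

theorem ancUpTo_suffix {i j : ℕ} (h : i ≤ j) : ancUpTo A d U v i <:+ ancUpTo A d U v j := by
  induction h with
  | refl => exact List.suffix_rfl
  | step _ ih => exact ih.trans (suffix_ancStep _ _ _ _ _)

theorem ancUpTo_of_mem {i j : ℕ} (h : i ≤ j) (hv : v ∈ ancUpTo A d U v i) :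
    ancUpTo A d U v j = ancUpTo A d U v i := by
  induction h with
  | refl => rfl
  | step _ ih => rw [ancUpTo, ih, ancStep_of_mem hv]

/-- The invariant of the search: as long as `v` is not reached, every step has added a vertex, and
the component of `v` in what is left still touches the current end of the branch. So the search
never gets stuck before `v`. -/
theorem ancUpTo_spec (hA : ∀ a b, A a b → A b a) (hd : ∀ p, IsPathIn A U p → p.length < d)
    (hv : v ∈ U) (i : ℕ) : IsPathIn A U (ancUpTo A d U v i) ∧
      (v ∉ ancUpTo A d U v i → (ancUpTo A d U v i).length = i ∧
        ∃ u ∈ without U (ancUpTo A d U v i), Conn A (without U (ancUpTo A d U v i)) u v ∧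
          ∀ x ∈ (ancUpTo A d U v i).head?, A u x) := by
  induction i with
  | zero =>
    exact ⟨⟨List.nodup_nil, List.isChain_nil, List.nil_subset _⟩, fun _ =>
      ⟨rfl, v, mem_without.2 ⟨hv, List.not_mem_nil⟩, Relation.ReflTransGen.refl,
        by simp [ancUpTo]⟩⟩
  | succ i ih =>
    rw [ancUpTo]
    generalize ancUpTo A d U v i = c at ih
    obtain ⟨⟨h1, h2, h3⟩, h5⟩ := ih
    by_cases hvc : v ∈ c
    · rw [ancStep_of_mem hvc]
      exact ⟨⟨h1, h2, h3⟩, fun h => absurd hvc h⟩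
    · obtain ⟨h5, u', hu', hc', hx'⟩ := h5 hvc
      rcases ancStep_cases hA hd hvc with ⟨_, h7⟩ | ⟨u, h7, hu, hv', hc, hxc⟩
      · exact absurd hx' (h7 u' hu' (mem_without.2 ⟨hv, hvc⟩) hc')
      · rw [h7]
        rw [mem_without] at hu
        refine ⟨⟨List.nodup_cons.2 ⟨hu.2, h1⟩, List.isChain_cons.2 ⟨hxc, h2⟩,
          List.cons_subset.2 ⟨hu.1, h3⟩⟩, fun hvu =>
          ⟨by rw [List.length_cons, h5], ?_⟩⟩
        -- On a path from the new vertex `u` to `v`, the second vertex is the required neighbour of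
        -- `u`, and the path from there on avoids `u`.
        obtain ⟨p, ⟨p1, p2, p3⟩, p4, p5⟩ := hc.exists_path hv'
        cases p with
        | nil => cases p4
        | cons a p =>
          obtain rfl : a = u := by simpa using p4
          cases p with
          | nil =>
            obtain rfl : a = v := by simpa using p5
            exact absurd List.mem_cons_self hvu
          | cons b p =>
            rw [List.nodup_cons] at p1
            rw [List.isChain_cons] at p2
            have hsub : b :: p ⊆ without U (a :: c) := fun x hx => by
              have := mem_without.1 (p3 (List.mem_cons_of_mem _ hx))
              refine mem_without.2 ⟨this.1, fun h => ?_⟩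
              rcases List.mem_cons.1 h with rfl | h
              · exact p1.1 hx
              · exact this.2 h
            refine ⟨b, hsub List.mem_cons_self, IsPathIn.conn_head p2.2 hsub rfl
              (List.mem_of_getLast? p5), fun x hx => ?_⟩
            obtain rfl : a = x := by simpa using hx
            exact hA _ _ (p2.1 b rfl)

/-- Whatever the branch picks up after step `i` lies in the component of `v` that was left at step
`i`. -/
theorem ancUpTo_conn (hA : ∀ a b, A a b → A b a) (hd : ∀ p, IsPathIn A U p → p.length < d)
    {i j : ℕ} (h : i ≤ j) (hu : u ∈ ancUpTo A d U v j) (hu' : u ∉ ancUpTo A d U v i) :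
    Conn A (without U (ancUpTo A d U v i)) u v := by
  induction h with
  | refl => exact absurd hu hu'
  | @step j hij ih =>
    by_cases huj : u ∈ ancUpTo A d U v j
    · exact ih huj
    · rw [Nat.succ_eq_add_one, ancUpTo] at hu
      by_cases hv : v ∈ ancUpTo A d U v j
      · rw [ancStep_of_mem hv] at hu
        exact absurd hu huj
      · rcases ancStep_cases hA hd hv with ⟨h7, _⟩ | ⟨w, h7, hw, hv', hc, hx⟩
        · exact absurd (h7 ▸ hu) huj
        · rw [h7, List.mem_cons] at hu
          obtain rfl := hu.resolve_right huj
          refine hc.mono fun x hx => ?_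
          rw [mem_without] at hx ⊢
          exact ⟨hx.1, fun h => hx.2 ((ancUpTo_suffix hij).subset h)⟩

theorem isPathIn_anc (hA : ∀ a b, A a b → A b a) (hd : ∀ p, IsPathIn A U p → p.length < d)
    (hv : v ∈ U) : IsPathIn A U (anc A d U v) :=
  (ancUpTo_spec hA hd hv d).1

theorem length_anc_le (A : ℕ → ℕ → Bool) (d : ℕ) (U : List ℕ) (v : ℕ) :
    (anc A d U v).length ≤ d := by
  suffices ∀ i, (ancUpTo A d U v i).length ≤ i from this d
  intro i
  induction i with
  | zero => exact le_rfl
  | succ i ih =>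
    rw [ancUpTo, ancStep]
    cases decide (v ∈ ancUpTo A d U v i)
    · rw [cond_false, List.length_append, add_comm]
      exact Nat.add_le_add ih (by cases List.head? _ <;> simp)
    · exact ih.trans (Nat.le_succ i)

/-- If `v` were missed, the branch would have made `d` full steps and be a path on `d` vertices. -/
theorem mem_anc_self (hA : ∀ a b, A a b → A b a) (hd : ∀ p, IsPathIn A U p → p.length < d)
    (hv : v ∈ U) : v ∈ anc A d U v := by
  by_contra h
  have h1 := ancUpTo_spec hA hd hv d
  have h2 := hd _ h1.1
  have h3 := (h1.2 h).1
  omega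

/-- The defining property of depth first search. The two branches agree until one of them reaches
its target, because adjacent vertices that are both still present lie in the same component. -/
theorem anc_suffix_of_adj (hA : ∀ a b, A a b → A b a)
    (hd : ∀ p, IsPathIn A U p → p.length < d) (hv : v ∈ U) (hw : w ∈ U) (h : A v w) :
    anc A d U v <:+ anc A d U w ∨ anc A d U w <:+ anc A d U v := by
  have key : ∀ i, ancUpTo A d U v i = ancUpTo A d U w i ∨
      (v ∈ ancUpTo A d U v i ∧ ancUpTo A d U v i <:+ ancUpTo A d U w i) ∨
      (w ∈ ancUpTo A d U w i ∧ ancUpTo A d U w i <:+ ancUpTo A d U v i) := by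
    intro i
    induction i with
    | zero => exact Or.inl rfl
    | succ i ih =>
      simp only [ancUpTo]
      generalize ancUpTo A d U v i = c at ih
      generalize ancUpTo A d U w i = c' at ih
      rcases ih with rfl | ⟨h1, h2⟩ | ⟨h1, h2⟩
      · by_cases h1 : v ∈ c
        · rw [ancStep_of_mem h1]
          exact Or.inr (Or.inl ⟨h1, suffix_ancStep _ _ _ _ _⟩)
        by_cases h2 : w ∈ c
        · rw [ancStep_of_mem h2]
          exact Or.inr (Or.inr ⟨h2, suffix_ancStep _ _ _ _ _⟩)
        have hv' := mem_without.2 ⟨hv, h1⟩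
        have hw' := mem_without.2 ⟨hw, h2⟩
        exact Or.inl (ancStep_congr hA hd hv' hw' (Relation.ReflTransGen.single ⟨h, hv', hw'⟩))
      · rw [ancStep_of_mem h1]
        exact Or.inr (Or.inl ⟨h1, h2.trans (suffix_ancStep _ _ _ _ _)⟩)
      · rw [ancStep_of_mem h1]
        exact Or.inr (Or.inr ⟨h1, h2.trans (suffix_ancStep _ _ _ _ _)⟩)
  rcases key d with h | h | h
  · exact Or.inl ((show anc A d U v = anc A d U w from h) ▸ List.suffix_rfl)
  · exact Or.inl h.2
  · exact Or.inr h.2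

/-- Until `u` is reached, it stays in the component of `v`, so both branches make the same choices.
-/
theorem anc_suffix_of_mem (hA : ∀ a b, A a b → A b a)
    (hd : ∀ p, IsPathIn A U p → p.length < d) (hv : v ∈ U) (hu : u ∈ anc A d U v) :
    anc A d U u <:+ anc A d U v := by
  have huU : u ∈ U := (isPathIn_anc hA hd hv).2.2 hu
  have key : ∀ i ≤ d, ancUpTo A d U u i = ancUpTo A d U v i ∨
      (u ∈ ancUpTo A d U u i ∧ ancUpTo A d U u i <:+ ancUpTo A d U v i) := by
    intro i
    induction i with
    | zero => exact fun _ => Or.inl rfl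
    | succ i ih =>
      intro hi
      have hi' : i ≤ d := (Nat.le_succ i).trans hi
      simp only [ancUpTo]
      rcases ih hi' with h | ⟨h1, h2⟩
      · rw [h]
        by_cases h1 : u ∈ ancUpTo A d U v i
        · rw [ancStep_of_mem h1]
          exact Or.inr ⟨h1, suffix_ancStep _ _ _ _ _⟩
        by_cases h2 : v ∈ ancUpTo A d U v i
        · rw [anc, ancUpTo_of_mem hi' h2] at hu
          exact absurd hu h1
        exact Or.inl (ancStep_congr hA hd (mem_without.2 ⟨huU, h1⟩) (mem_without.2 ⟨hv, h2⟩)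
          (ancUpTo_conn hA hd hi' hu h1))
      · rw [ancStep_of_mem h1]
        exact Or.inr ⟨h1, h2.trans (suffix_ancStep _ _ _ _ _)⟩
  rcases key d le_rfl with h | h
  · exact (show anc A d U u = anc A d U v from h) ▸ List.suffix_rfl
  · exact h.2

end forest

/-! ### Groups: the vertices outside a set closed under ancestors -/

section groups
variable {A : ℕ → ℕ → Bool} {F C c : List ℕ} {d : ℕ} {u v w : ℕ}

/-- The ancestors of `v` in `C`. -/
def ancIn (A : ℕ → ℕ → Bool) (d : ℕ) (F C : List ℕ) (v : ℕ) : List ℕ :=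
  (anc A d F v).filter fun u => decide (u ∈ C)

theorem mem_group : v ∈ group A d F C c ↔ v ∈ F ∧ v ∉ C ∧ ancIn A d F C v = c := by
  simp [group, ancIn]

/-- An ancestor of `w` strictly below `v` cannot be in `C`, since `v` is among its ancestors and
would then be in `C`, too. -/
theorem ancIn_eq_of_suffix (hA : ∀ a b, A a b → A b a)
    (hd : ∀ p, IsPathIn A F p → p.length < d) (hC : ∀ u ∈ C, anc A d F u ⊆ C)
    (hv : v ∈ F) (hvC : v ∉ C) (hw : w ∈ F) (h : anc A d F v <:+ anc A d F w) :
    ancIn A d F C v = ancIn A d F C w := by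
  obtain ⟨s, hs⟩ := h
  have hnd := (isPathIn_anc hA hd hw).1
  rw [ancIn, ancIn, ← hs, List.filter_append]
  suffices s.filter (fun u => decide (u ∈ C)) = [] by rw [this, List.nil_append]
  rw [List.filter_eq_nil_iff]
  intro u hu huC
  rw [decide_eq_true_iff] at huC
  have huw : u ∈ anc A d F w := by rw [← hs]; exact List.mem_append_left _ hu
  have huF := (isPathIn_anc hA hd hw).2.2 huw
  rcases List.suffix_or_suffix_of_suffix (anc_suffix_of_mem hA hd hw huw) ⟨s, hs⟩ with h | h
  · have := h.subset (mem_anc_self hA hd huF)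
    rw [← hs] at hnd
    exact (List.nodup_append.1 hnd).2.2 u hu u this rfl
  · exact hvC (hC u huC (h.subset (mem_anc_self hA hd hv)))

/-- Consequently a path outside `C` never leaves its group. -/
theorem ancIn_eq_of_adj (hA : ∀ a b, A a b → A b a)
    (hd : ∀ p, IsPathIn A F p → p.length < d) (hC : ∀ u ∈ C, anc A d F u ⊆ C)
    (hv : v ∈ F) (hvC : v ∉ C) (hw : w ∈ F) (hwC : w ∉ C) (h : A v w) :
    ancIn A d F C v = ancIn A d F C w := by
  rcases anc_suffix_of_adj hA hd hv hw h with h | h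
  · exact ancIn_eq_of_suffix hA hd hC hv hvC hw h
  · exact (ancIn_eq_of_suffix hA hd hC hw hwC hv h).symm

theorem mem_anc_of_adj (hA : ∀ a b, A a b → A b a)
    (hd : ∀ p, IsPathIn A F p → p.length < d) (hv : v ∈ F) (hw : w ∈ F) (h : A v w) :
    v ∈ anc A d F w ∨ w ∈ anc A d F v := by
  rcases anc_suffix_of_adj hA hd hv hw h with h | h
  · exact Or.inl (h.subset (mem_anc_self hA hd hv))
  · exact Or.inr (h.subset (mem_anc_self hA hd hw))

/-- One of the two vertices is an ancestor of the other; `v` above `w` would force `v` into `C`. -/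
theorem mem_ancIn_of_adj (hA : ∀ a b, A a b → A b a)
    (hd : ∀ p, IsPathIn A F p → p.length < d) (hC : ∀ u ∈ C, anc A d F u ⊆ C)
    (hv : v ∈ F) (hvC : v ∉ C) (hw : w ∈ F) (hwC : w ∈ C) (h : A v w) :
    w ∈ ancIn A d F C v := by
  rcases mem_anc_of_adj hA hd hv hw h with h | h
  · exact absurd (hC w hwC h) hvC
  · exact List.mem_filter.2 ⟨h, by simpa⟩

theorem length_ancIn_le (A : ℕ → ℕ → Bool) (d : ℕ) (F C : List ℕ) (v : ℕ) :
    (ancIn A d F C v).length ≤ d :=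
  (List.length_filter_le _ _).trans (length_anc_le A d F v)

theorem exists_first {l : List ℕ} {p : ℕ → Prop} (h : ∃ x ∈ l, p x) :
    ∃ s a t, l = s ++ a :: t ∧ p a ∧ ∀ x ∈ s, ¬ p x := by
  induction l with
  | nil => simp at h
  | cons b l ih =>
    by_cases hb : p b
    · exact ⟨[], b, l, rfl, hb, by simp⟩
    · obtain ⟨x, hx, hpx⟩ := h
      rcases List.mem_cons.1 hx with rfl | hx
      · exact absurd hpx hb
      · obtain ⟨s, a, t, rfl, ha, hs⟩ := ih ⟨x, hx, hpx⟩
        refine ⟨b :: s, a, t, rfl, ha, fun y hy => ?_⟩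
        rcases List.mem_cons.1 hy with rfl | hy
        · exact hb
        · exact hs y hy

/-- Take the deepest ancestor `a` of `v` in `C`, which comes first in the list since branches are
listed upwards. This lets `marks` reach every group with nonempty `c` by running over `C`. -/
theorem exists_ancIn_eq_anc (hA : ∀ a b, A a b → A b a)
    (hd : ∀ p, IsPathIn A F p → p.length < d) (hC : ∀ u ∈ C, anc A d F u ⊆ C)
    (hv : v ∈ F) (h : ancIn A d F C v ≠ []) : ∃ a ∈ C, ancIn A d F C v = anc A d F a := by
  obtain ⟨x, hx⟩ := List.exists_mem_of_ne_nil _ h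
  have hx' := List.mem_filter.1 hx
  obtain ⟨s, a, t, e, ha, hs⟩ := exists_first ⟨x, hx'.1, of_decide_eq_true hx'.2⟩
  have hav : a ∈ anc A d F v := by rw [e]; simp
  have haF := (isPathIn_anc hA hd hv).2.2 hav
  have hsuf := anc_suffix_of_mem hA hd hv hav
  have hnd := (isPathIn_anc hA hd hv).1
  refine ⟨a, ha, ?_⟩
  have e1 : anc A d F a = a :: t := by
    rcases List.suffix_or_suffix_of_suffix hsuf ⟨s, e.symm⟩ with h | h
    · rcases List.suffix_cons_iff.1 h with h | h
      · exact h
      · have := h.subset (mem_anc_self hA hd haF)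
        rw [e] at hnd
        exact absurd this (List.nodup_cons.1 (List.nodup_append.1 hnd).2.1).1
    -- Extra vertices on the branch of `a` would be ancestors of `a`, hence in `C`, but also lie in
    -- `s`, which has no vertex of `C`.
    · obtain ⟨r, hr⟩ := h
      obtain ⟨q, hq⟩ := hsuf
      rw [e, ← hr, ← List.append_assoc] at hq
      have hq' := List.append_cancel_right hq
      cases r with
      | nil => exact hr.symm
      | cons y r =>
        refine absurd (hC a ha ?_) (hs y ?_)
        · rw [← hr]; simp
        · rw [← hq']; simp
  have e2 : s.filter (fun u => decide (u ∈ C)) = [] := by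
    rw [List.filter_eq_nil_iff]
    intro u hu; simpa using hs u hu
  rw [ancIn, e, List.filter_append, e2, List.nil_append, ← e1, List.filter_eq_self]
  intro u hu
  simpa using hC a ha hu

end groups

section closeUp
variable {A : ℕ → ℕ → Bool} {F H : List ℕ} {d : ℕ} {u v : ℕ}

theorem subset_closeUp (hA : ∀ a b, A a b → A b a)
    (hd : ∀ p, IsPathIn A F p → p.length < d) (hH : H ⊆ F) : H ⊆ closeUp A d F H :=
  fun v hv => List.mem_flatMap.2 ⟨v, hv, mem_anc_self hA hd (hH hv)⟩

theorem closeUp_subset (hA : ∀ a b, A a b → A b a)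
    (hd : ∀ p, IsPathIn A F p → p.length < d) (hH : H ⊆ F) : closeUp A d F H ⊆ F := by
  intro v hv
  obtain ⟨h, hh, hv⟩ := List.mem_flatMap.1 hv
  exact (isPathIn_anc hA hd (hH hh)).2.2 hv

theorem anc_subset_closeUp (hA : ∀ a b, A a b → A b a)
    (hd : ∀ p, IsPathIn A F p → p.length < d) (hH : H ⊆ F) :
    ∀ u ∈ closeUp A d F H, anc A d F u ⊆ closeUp A d F H := by
  intro u hu v hv
  obtain ⟨h, hh, hu⟩ := List.mem_flatMap.1 hu
  exact List.mem_flatMap.2 ⟨h, hh, (anc_suffix_of_mem hA hd (hH hh) hu).subset hv⟩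

end closeUp

/-! ### Replacing the stretches of a path -/

/-- If every maximal stretch of vertices of the kind `N` in a path can be replaced, then all of
them can. -/
theorem exists_path_of_replace {A₁ A₂ : ℕ → ℕ → Bool} {N T₁ T₂ : ℕ → Prop} [DecidablePred N]
    {d : ℕ} (h21 : ∀ a b, A₂ a b → A₁ a b) (hT : ∀ v, T₂ v → T₁ v)
    (hB : ∀ a b, A₁ a b → T₁ a → T₁ b → ¬ N a → ¬ N b → A₂ a b)
    (hBT : ∀ v, T₁ v → ¬ N v → T₂ v)
    (hrep : ∀ L Q R : List ℕ, (L ++ (Q ++ R)).length = d → (L ++ (Q ++ R)).Nodup →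
      (L ++ (Q ++ R)).IsChain (fun a b => A₁ a b) → (∀ v ∈ L ++ (Q ++ R), T₁ v) → Q ≠ [] →
      (∀ v ∈ Q, N v) → (∀ x ∈ L.getLast?, ¬ N x) → (∀ x ∈ R.head?, ¬ N x) →
      ∃ Q' : List ℕ, Q'.length = Q.length ∧ Q'.Nodup ∧ Q'.IsChain (fun a b => A₂ a b) ∧
        (∀ v ∈ Q', T₂ v) ∧ (∀ v ∈ Q', v ∉ L ∧ v ∉ R) ∧
        (∀ x ∈ L.getLast?, ∀ y ∈ Q'.head?, A₂ x y) ∧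
        (∀ x ∈ Q'.getLast?, ∀ y ∈ R.head?, A₂ x y))
    {P : List ℕ} (hPd : P.length = d) (hPn : P.Nodup) (hPc : P.IsChain (fun a b => A₁ a b))
    (hPT : ∀ v ∈ P, T₁ v) :
    ∃ P' : List ℕ, P'.length = d ∧ P'.Nodup ∧ P'.IsChain (fun a b => A₂ a b) ∧
      ∀ v ∈ P', T₂ v := by
  -- `L` is the part already rewritten and `R` the untouched rest. The last vertex of `L` is kept
  -- outside `N`, so that the next stretch is maximal.
  suffices key : ∀ (n : ℕ) (L R : List ℕ), R.length ≤ n → (L ++ R).length = d → (L ++ R).Nodup →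
      (L ++ R).IsChain (fun a b => A₁ a b) → (∀ v ∈ R, T₁ v) →
      L.IsChain (fun a b => A₂ a b) → (∀ v ∈ L, T₂ v) → (∀ x ∈ L.getLast?, ¬ N x) →
      ∃ P' : List ℕ, P'.length = d ∧ P'.Nodup ∧ P'.IsChain (fun a b => A₂ a b) ∧
        ∀ v ∈ P', T₂ v from
    key _ [] P le_rfl hPd hPn hPc hPT List.isChain_nil (by simp) (by simp)
  intro n
  induction n with
  | zero =>
    intro L R hn h1 h2 _ _ h5 h6 _
    obtain rfl := List.length_eq_zero_iff.1 (Nat.le_zero.1 hn)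
    rw [List.append_nil] at h1 h2
    exact ⟨L, h1, h2, h5, h6⟩
  | succ n ih =>
    intro L R hn h1 h2 h3 h4 h5 h6 h7
    cases R with
    | nil =>
      rw [List.append_nil] at h1 h2
      exact ⟨L, h1, h2, h5, h6⟩
    | cons r R =>
      by_cases hr : N r
      · have hQR := List.takeWhile_append_dropWhile (p := fun v => decide (N v)) (l := r :: R)
        have hQ : ∀ v ∈ (r :: R).takeWhile (fun v => decide (N v)), N v := fun v hv =>
          of_decide_eq_true (List.mem_takeWhile_imp (p := fun v => decide (N v)) hv)
        have hQ0 : (r :: R).takeWhile (fun v => decide (N v)) ≠ [] := by simp [hr]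
        have hR2 : ∀ x ∈ ((r :: R).dropWhile (fun v => decide (N v))).head?, ¬ N x := by
          intro x hx
          have := List.head?_dropWhile_not (fun v => decide (N v)) (r :: R)
          rw [Option.mem_def.1 hx] at this
          simpa using this
        generalize (r :: R).takeWhile (fun v => decide (N v)) = Q at hQR hQ hQ0
        generalize (r :: R).dropWhile (fun v => decide (N v)) = R₂ at hQR hR2
        rw [← hQR] at h1 h2 h3 h4 hn
        obtain ⟨Q', q1, q2, q3, q4, q5, q6, q7⟩ := hrep L Q R₂ h1 h2 h3 (fun v hv => by
          rcases List.mem_append.1 hv with hv | hv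
          · exact hT v (h6 v hv)
          · exact h4 v hv) hQ0 hQ h7 hR2
        have hQl := List.length_pos_of_ne_nil hQ0
        have c1 : (L ++ Q').IsChain (fun a b => A₂ a b) := List.isChain_append.2 ⟨h5, q3, q6⟩
        have c2 : (L ++ Q').Nodup := List.nodup_append.2 ⟨(List.nodup_append.1 h2).1, q2,
          fun a ha b hb hab => (q5 b hb).1 (hab ▸ ha)⟩
        have c3 : ∀ v ∈ L ++ Q', T₂ v := fun v hv => by
          rcases List.mem_append.1 hv with hv | hv
          · exact h6 v hv
          · exact q4 v hv
        have c4 : (L ++ Q').getLast? = Q'.getLast? := by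
          rw [List.getLast?_append]
          cases hx : Q'.getLast? with
          | none =>
            rw [List.getLast?_eq_none_iff] at hx
            rw [hx, List.length_nil] at q1
            omega
          | some x => rfl
        cases R₂ with
        | nil =>
          refine ⟨L ++ Q', ?_, c2, c1, c3⟩
          simp only [List.length_append, List.length_nil] at h1 ⊢
          omega
        | cons s R₃ =>
          have hs : ¬ N s := hR2 s rfl
          have hsT : T₁ s := h4 s (by simp)
          have nd := h2
          rw [List.nodup_append] at nd
          have nd2 := List.nodup_append.1 nd.2.1
          have ch := (List.isChain_append.1 (List.isChain_append.1 h3).2.1).2.1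
          -- The vertex `s` after the stretch is moved over as well, because `Q'` may end in `N` and
          -- would break the invariant.
          refine ih (L ++ Q' ++ [s]) R₃ ?_ ?_ ?_ ?_ ?_ ?_ ?_ ?_
          · simp only [List.length_append, List.length_cons] at hn; omega
          · simp only [List.length_append, List.length_cons, List.length_nil] at h1 ⊢; omega
          · rw [List.append_assoc, List.singleton_append, List.nodup_append]
            refine ⟨c2, nd2.2.1, fun a ha b hb hab => ?_⟩
            subst hab
            rcases List.mem_append.1 ha with ha | ha
            · exact nd.2.2 a ha a (List.mem_append_right _ hb) rfl
            · exact (q5 a ha).2 hb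
          · rw [List.append_assoc, List.singleton_append, List.isChain_append]
            refine ⟨c1.imp fun a b => h21 a b, ch, fun x hx y hy => ?_⟩
            rw [c4] at hx
            exact h21 _ _ (q7 x hx y hy)
          · exact fun v hv => h4 v (by simp [hv])
          · rw [List.isChain_append]
            refine ⟨c1, by simp, fun x hx y hy => ?_⟩
            rw [c4] at hx
            exact q7 x hx y (by simpa using hy)
          · intro v hv
            rcases List.mem_append.1 hv with hv | hv
            · exact c3 v hv
            · rw [List.mem_singleton.1 hv]; exact hBT s hsT hs
          · intro x hx
            rw [List.getLast?_append] at hx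
            obtain rfl : s = x := by simpa using hx
            exact hs
      · have hrT : T₁ r := h4 r List.mem_cons_self
        refine ih (L ++ [r]) R (by simpa using hn) (by simpa using h1) (by simpa using h2)
          (by simpa using h3) (fun v hv => h4 v (List.mem_cons_of_mem _ hv)) ?_ ?_ ?_
        · rw [List.isChain_append] at h3 ⊢
          refine ⟨h5, by simp, fun x hx y hy => ?_⟩
          obtain rfl : r = y := by simpa using hy
          exact hB x r (h3.2.2 x hx r rfl) (hT x (h6 x (List.mem_of_getLast? hx))) hrT (h7 x hx) hr
        · intro v hv
          rcases List.mem_append.1 hv with hv | hv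
          · exact h6 v hv
          · rw [List.mem_singleton.1 hv]; exact hBT r hrT hr
        · intro x hx
          rw [List.getLast?_append] at hx
          obtain rfl : r = x := by simpa using hx
          exact hr

/-! ### Segments, their packings and their marks -/

/-- Some set of at most `k` vertices meets every path on `d` vertices in `V`. -/
def HasCover (A : ℕ → ℕ → Bool) (V : List ℕ) (d k : ℕ) : Prop :=
  ∃ S : Finset ℕ, S.card ≤ k ∧ ∀ P : List ℕ, P.length = d → IsPathIn A V P → ∃ v ∈ P, v ∈ S

section
variable {A : ℕ → ℕ → Bool} {d k l n : ℕ} {U V M F C c Q : List ℕ} {a b : Option ℕ}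

theorem mem_segments : Q ∈ segments A d U a b l ↔ Q.length ≤ d ∧ IsPathIn A U Q ∧ Q.length = l ∧
    (∀ x ∈ a, ∀ v ∈ Q.head?, A x v) ∧ ∀ v ∈ Q.getLast?, ∀ y ∈ b, A v y := by
  simp only [segments, List.mem_filter, mem_pathsUpTo, Bool.and_eq_true, decide_eq_true_iff,
    Option.all_eq_true, List.head?_reverse, IsPathIn, Option.mem_def]
  grind

theorem mem_ends {a : Option ℕ} : a ∈ ends M ↔ ∀ x ∈ a, x ∈ M := by
  cases a <;> simp [ends]

theorem pack_subset_linkers {K : ℕ} (ha : a ∈ ends M) (hb : b ∈ ends M) (hl : l ≤ d) :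
    (pack K (segments A d F a b l)).flatten ⊆ linkers A d K M F := fun _ hv =>
  List.mem_flatMap.2 ⟨a, ha, List.mem_flatMap.2 ⟨b, hb, List.mem_flatMap.2 ⟨l,
    List.mem_range.2 (Nat.lt_succ_of_le hl), hv⟩⟩⟩

theorem linkers_subset {K : ℕ} : linkers A d K M F ⊆ F := by
  intro v hv
  simp only [linkers, List.mem_flatMap] at hv
  obtain ⟨a, _, b, _, l, _, hv⟩ := hv
  obtain ⟨Q, hQ, hv⟩ := List.mem_flatten.1 hv
  exact (mem_segments.1 ((pack_spec _ _).1 hQ)).2.1.2.2 hv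

/-- A segment disjoint from all linkers could have been added to the packing for its ends and
length, so that packing is full; one of its `K` disjoint members avoids `Z`. -/
theorem linkers_spec {K : ℕ} (ha : a ∈ ends M) (hb : b ∈ ends M)
    (hQ : Q ∈ segments A d F a b l) (hne : Q ≠ []) (hQH : ∀ v ∈ Q, v ∉ linkers A d K M F)
    {Z : Finset ℕ} (hZ : Z.card < K) :
    ∃ Q' ∈ segments A d F a b l, Q' ⊆ linkers A d K M F ∧ ∀ v ∈ Q', v ∉ Z := by
  have hl : l ≤ d := (mem_segments.1 hQ).2.2.1 ▸ (mem_segments.1 hQ).1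
  have hsub := pack_subset_linkers (A := A) (F := F) (K := K) ha hb hl
  obtain ⟨h1, h2, h3, h4⟩ := pack_spec K (segments A d F a b l)
  have hK : K ≤ (pack K (segments A d F a b l)).length := by
    by_contra h
    obtain ⟨v, hv, hv'⟩ := h4 (not_le.1 h) Q hQ hne
    exact hQH v hv (hsub hv')
  obtain ⟨Q', hQ', hZ'⟩ := exists_disjoint_of_card_lt h3 Z (hZ.trans_le hK)
  exact ⟨Q', h1 hQ', fun v hv => hsub (List.mem_flatten.2 ⟨Q', hQ', hv⟩), hZ'⟩

theorem groupMarks_spec (hab : (a, b) ∈ groupEnds M c)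
    (hQ : Q ∈ segments A d (group A d F C c) a b l) {Z : Finset ℕ} (hZ : Z.card ≤ 2 * d)
    (hQZ : ∀ v ∈ Q, v ∉ Z) :
    ∃ Q' ∈ segments A d (group A d F C c) a b l, (∀ v ∈ Q', v ∉ Z) ∧
      ∀ v ∈ Q', (a, v) ∈ groupMarks A d M F C c ∧ (b, v) ∈ groupMarks A d M F C c := by
  have hl : l ≤ d := (mem_segments.1 hQ).2.2.1 ▸ (mem_segments.1 hQ).1
  obtain ⟨Q', h1, h2⟩ := rep_spec hZ hQ hQZ
  refine ⟨Q', rep_subset _ _ h1, h2, fun v hv => ?_⟩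
  have : ∀ o : Option ℕ, (o = a ∨ o = b) → (o, v) ∈ groupMarks A d M F C c := fun o ho =>
    List.mem_flatMap.2 ⟨(a, b), hab, List.mem_flatMap.2 ⟨l,
      List.mem_range.2 (Nat.lt_succ_of_le hl), List.mem_flatMap.2 ⟨v,
        List.mem_flatten.2 ⟨Q', h1, hv⟩, by rcases ho with rfl | rfl <;> simp⟩⟩⟩
  exact ⟨this a (Or.inl rfl), this b (Or.inr rfl)⟩

theorem mem_groupEnds : (a, b) ∈ groupEnds M c ↔
    ((∃ x ∈ b, x ∈ c) ∧ (a ∈ ends M ∨ ∃ x ∈ a, x ∈ c)) ∨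
    ((∃ x ∈ a, x ∈ c) ∧ (b ∈ ends M ∨ ∃ x ∈ b, x ∈ c)) := by
  simp only [groupEnds, List.mem_flatMap, List.mem_append, List.mem_map, List.mem_cons,
    List.not_mem_nil, or_false, Prod.mk.injEq, Option.mem_def]
  grind

theorem keepAdj_iff {W : List (Option ℕ × ℕ)} {u v : ℕ} : keepAdj A M C W u v ↔ A u v ∧
    (((u ∈ M ∨ u ∈ C) ∧ (v ∈ M ∨ v ∈ C)) ∨ (u ∉ M ∧ v ∉ M) ∨ (some u, v) ∈ W ∨
      (some v, u) ∈ W) := by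
  simp only [keepAdj, Bool.and_eq_true, Bool.or_eq_true, decide_eq_true_iff, Bool.not_eq_true',
    decide_eq_false_iff_not, List.any_eq_true, exists_eq_right]
  tauto

theorem mem_keepVerts {W : List (Option ℕ × ℕ)} {v : ℕ} : v ∈ keepVerts n M C W ↔
    v < n ∧ (v ∈ M ∨ v ∈ C ∨ ∃ o, (o, v) ∈ W) := by
  simp only [keepVerts, List.mem_filter, List.mem_range, Bool.or_eq_true, decide_eq_true_iff,
    List.mem_map, Prod.exists, exists_eq_right]
  tauto

end

/-! ### Correctness of the kernel -/

section
variable {A : ℕ → ℕ → Bool} {d k l n : ℕ} {U U' M F C c L Q R : List ℕ} {a b : Option ℕ}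
  {W : List (Option ℕ × ℕ)}

theorem segments_mono (h : U ⊆ U') : segments A d U a b l ⊆ segments A d U' a b l := by
  intro Q hQ
  rw [mem_segments] at hQ ⊢
  exact ⟨hQ.1, ⟨hQ.2.1.1, hQ.2.1.2.1, fun _ hx => h (hQ.2.1.2.2 hx)⟩, hQ.2.2⟩

/-- A stretch of a path is a segment. -/
theorem mem_segments_of_isChain (hc : (L ++ (Q ++ R)).IsChain (fun a b => A a b))
    (hn : (L ++ (Q ++ R)).Nodup) (hd : (L ++ (Q ++ R)).length = d) (hU : Q ⊆ U) :
    Q ∈ segments A d U L.getLast? R.head? Q.length := by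
  rw [List.isChain_append] at hc
  have hc2 := List.isChain_append.1 hc.2.1
  rw [mem_segments]
  refine ⟨?_, ⟨(List.nodup_append.1 (List.nodup_append.1 hn).2.1).1, hc2.1, hU⟩, rfl, ?_, hc2.2.2⟩
  · simp only [List.length_append] at hd; omega
  · intro x hx v hv
    refine hc.2.2 x hx v ?_
    rw [List.head?_append, Option.mem_def.1 hv]
    rfl

theorem core_spec (hA : ∀ a b, A a b → A b a) (hd : ∀ p, IsPathIn A F p → p.length < d) :
    linkers A d (k + 2 * d) M F ⊆ core A d k M F ∧ core A d k M F ⊆ F ∧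
      ∀ u ∈ core A d k M F, anc A d F u ⊆ core A d k M F :=
  ⟨subset_closeUp hA hd linkers_subset, closeUp_subset hA hd linkers_subset,
    anc_subset_closeUp hA hd linkers_subset⟩

/-- A segment all of whose vertices are kept for its ends is a segment of the kernel. -/
theorem kept_segment (hA : ∀ a b, A a b → A b a) (hF : ∀ v, v ∈ F ↔ v < n ∧ v ∉ M)
    (ha : ∀ x ∈ a, x ∈ M ∨ x ∈ F) (hb : ∀ x ∈ b, x ∈ M ∨ x ∈ F) (hQ : Q ∈ segments A d F a b l)
    (hk : ∀ v ∈ Q, v ∈ C ∨ ((a, v) ∈ W ∧ (b, v) ∈ W)) :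
    Q.IsChain (fun a b => keepAdj A M C W a b) ∧ Q ⊆ keepVerts n M C W ∧
      (∀ x ∈ a, ∀ v ∈ Q.head?, keepAdj A M C W x v) ∧
      ∀ v ∈ Q.getLast?, ∀ y ∈ b, keepAdj A M C W v y := by
  obtain ⟨_, ⟨_, h2, h3⟩, _, h4, h5⟩ := mem_segments.1 hQ
  have key : ∀ o x v, o = some x → A x v → v ∈ Q → (v ∈ C ∨ (o, v) ∈ W) → (x ∈ M ∨ x ∈ F) →
      keepAdj A M C W x v ∧ keepAdj A M C W v x := by
    rintro o x v rfl hxv hv hvk hx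
    have hvM := ((hF v).1 (h3 hv)).2
    rw [keepAdj_iff, keepAdj_iff]
    have hvx := hA _ _ hxv
    rcases hx with hx | hx
    · tauto
    · have := ((hF x).1 hx).2
      tauto
  refine ⟨?_, fun v hv => ?_, fun x hx v hv => ?_, fun v hv y hy => ?_⟩
  · rw [List.isChain_iff_getElem] at h2 ⊢
    intro i hi
    rw [keepAdj_iff]
    exact ⟨h2 i hi, Or.inr (Or.inl ⟨((hF _).1 (h3 (List.getElem_mem _))).2,
      ((hF _).1 (h3 (List.getElem_mem _))).2⟩)⟩
  · rw [mem_keepVerts]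
    refine ⟨((hF v).1 (h3 hv)).1, ?_⟩
    rcases hk v hv with h | h
    · exact Or.inr (Or.inl h)
    · exact Or.inr (Or.inr ⟨a, h.1⟩)
  · have hv' := List.mem_of_mem_head? hv
    exact (key a x v hx (h4 x hx v hv) hv' ((hk v hv').imp_right And.left) (ha x hx)).1
  · have hv' := List.mem_of_getLast? hv
    exact (key b y v hy (hA _ _ (h5 v hv y hy)) hv' ((hk v hv').imp_right And.right) (hb y hy)).2

/-- The neighbours of a group. -/
theorem mem_of_adj_group (hA : ∀ a b, A a b → A b a)
    (hd : ∀ p, IsPathIn A F p → p.length < d) (hC : ∀ u ∈ C, anc A d F u ⊆ C)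
    (hF : ∀ v, v ∈ F ↔ v < n ∧ v ∉ M) {q x : ℕ} (hq : q ∈ group A d F C c) (hx : x < n)
    (h : A q x) : x ∈ M ∨ x ∈ c ∨ x ∈ group A d F C c := by
  by_cases hxM : x ∈ M
  · exact Or.inl hxM
  obtain ⟨h1, h2, rfl⟩ := mem_group.1 hq
  have hxF := (hF x).2 ⟨hx, hxM⟩
  by_cases hxC : x ∈ C
  · exact Or.inr (Or.inl (mem_ancIn_of_adj hA hd hC h1 h2 hxF hxC h))
  · exact Or.inr (Or.inr (mem_group.2 ⟨hxF, hxC, (ancIn_eq_of_adj hA hd hC h1 h2 hxF hxC h).symm⟩))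

/-- Deleting the ancestors of a group does the work of deleting vertices in the group. -/
theorem exchange (hA : ∀ a b, A a b → A b a) (hF : ∀ v, v ∈ F ↔ v < n ∧ v ∉ M)
    (hd : ∀ p, IsPathIn A F p → p.length < d) (hC : C = core A d k M F) {S : Finset ℕ}
    (hSk : S.card ≤ k)
    (hS : ∀ P : List ℕ, P.length = d → IsPathIn (keepAdj A M C W) (keepVerts n M C W) P →
      ∃ v ∈ P, v ∈ S) (hc : c.length ≤ d) :
    ∀ P : List ℕ, P.length = d → IsPathIn (keepAdj A M C W) (keepVerts n M C W) P →
      ∃ v ∈ P, v ∈ S.filter (fun v => v ∉ group A d F C c) ∪ c.toFinset := by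
  intro P hPd hP
  by_contra hPS
  push Not at hPS
  obtain ⟨hCH, hCF, hCC⟩ := core_spec (k := k) (M := M) hA hd
  rw [← hC] at hCH hCF hCC
  -- A path avoiding the new set can meet `S` only inside the group. Replacing its stretches there
  -- by linkers gives a path avoiding `S` altogether, against `hS`.
  refine Exists.elim (exists_path_of_replace (A₁ := keepAdj A M C W)
    (A₂ := keepAdj A M C W) (N := fun v => v ∈ group A d F C c)
    (T₁ := fun v => v ∈ keepVerts n M C W ∧ (v ∈ S → v ∈ group A d F C c) ∧ v ∉ c)
    (T₂ := fun v => v ∈ keepVerts n M C W ∧ v ∉ S ∧ v ∉ c) (d := d)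
    (fun _ _ h => h) (fun v hv => ⟨hv.1, fun h => absurd h hv.2.1, hv.2.2⟩)
    (fun _ _ h _ _ _ _ => h) (fun v hv hN => ⟨hv.1, fun h => hN (hv.2.1 h), hv.2.2⟩) ?hrep
    hPd hP.1 hP.2.1 (fun v hv => by
      have := hPS v hv
      rw [Finset.mem_union, Finset.mem_filter, List.mem_toFinset] at this
      exact ⟨hP.2.2 hv, by tauto, by tauto⟩)) ?main
  case main =>
    rintro P' ⟨p1, p2, p3, p4⟩
    obtain ⟨v, hv, hvS⟩ := hS P' p1 ⟨p2, p3, fun v hv => (p4 v hv).1⟩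
    exact (p4 v hv).2.1 hvS
  · intro L Q R e1 e2 e3 e4 hQ0 hQN hL hR
    have e3' : (L ++ (Q ++ R)).IsChain (fun a b => A a b) :=
      e3.imp fun a b h => (keepAdj_iff.1 h).1
    have hQF : Q ⊆ F := fun v hv => (mem_group.1 (hQN v hv)).1
    have hseg := mem_segments_of_isChain (U := F) e3' e2 e1 hQF
    obtain ⟨_, _, _, s4, s5⟩ := mem_segments.1 hseg
    -- A neighbour of the stretch is in `M`, in `c` or in the group; `c` is deleted, and the stretch
    -- is maximal in the group.
    have ha : L.getLast? ∈ ends M := mem_ends.2 fun x hx => by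
      obtain ⟨q, Q, rfl⟩ := List.exists_cons_of_ne_nil hQ0
      have hxT := e4 x (List.mem_append_left _ (List.mem_of_getLast? hx))
      rcases mem_of_adj_group hA hd hCC hF (hQN q List.mem_cons_self)
        (mem_keepVerts.1 hxT.1).1 (hA _ _ (s4 x hx q rfl)) with h | h | h
      · exact h
      · exact absurd h hxT.2.2
      · exact absurd h (hL x hx)
    have hb : R.head? ∈ ends M := mem_ends.2 fun x hx => by
      have hq := List.getLast?_eq_some_getLast hQ0
      have hxT := e4 x (List.mem_append_right _ (List.mem_append_right _
        (List.mem_of_mem_head? hx)))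
      rcases mem_of_adj_group hA hd hCC hF (hQN _ (List.getLast_mem hQ0))
        (mem_keepVerts.1 hxT.1).1 (s5 _ hq x hx) with h | h | h
      · exact h
      · exact absurd h hxT.2.2
      · exact absurd h (hR x hx)
    obtain ⟨Q', hQ', hQH, hQZ⟩ := linkers_spec (K := k + 2 * d) ha hb hseg hQ0
      (fun v hv h => (mem_group.1 (hQN v hv)).2.1 (hCH h))
      -- At most `k` vertices of `S`, at most `d` of `c`, and fewer than `d` on the rest of the path
      -- since `Q` is nonempty: this is the origin of `k + 2 * d`.
      (Z := S ∪ c.toFinset ∪ (L ++ R).toFinset) (by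
        have h1 := Finset.card_union_le (S ∪ c.toFinset) (L ++ R).toFinset
        have h2 := Finset.card_union_le S c.toFinset
        have h3 := List.toFinset_card_le c
        have h4 := List.toFinset_card_le (L ++ R)
        have h5 := List.length_pos_of_ne_nil hQ0
        simp only [List.length_append] at e1 h4
        omega)
    obtain ⟨k1, k2, k3, k4⟩ := kept_segment (W := W) (C := C) hA hF
      (fun x hx => Or.inl (mem_ends.1 ha x hx)) (fun x hx => Or.inl (mem_ends.1 hb x hx)) hQ'
      (fun v hv => Or.inl (hCH (hQH hv)))
    obtain ⟨_, t2, t3, _⟩ := mem_segments.1 hQ'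
    refine ⟨Q', t3, t2.1, k1, fun v hv => ?_, fun v hv => ?_, k3, k4⟩
    · have := hQZ v hv
      simp only [Finset.mem_union, List.mem_toFinset, List.mem_append] at this
      exact ⟨k2 hv, by tauto, by tauto⟩
    · have := hQZ v hv
      simp only [Finset.mem_union, List.mem_toFinset, List.mem_append] at this
      tauto

/-- Minimum solutions of the kernel are solutions. -/
theorem cover_of_kernel_cover (hA : ∀ a b, A a b → A b a) (hF : ∀ v, v ∈ F ↔ v < n ∧ v ∉ M)
    (hd : ∀ p, IsPathIn A F p → p.length < d) (hC : C = core A d k M F)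
    (hW : W = marks A d M F C) {S : Finset ℕ} (hSk : S.card ≤ k)
    (hS : ∀ c : List ℕ, c.length ≤ d →
      (S.filter fun v => v ∈ group A d F C c).card ≤ c.length)
    {P : List ℕ} (hPd : P.length = d) (hP : IsPathIn A (List.range n) P)
    (hPS : ∀ v ∈ P, v ∉ S) :
    ∃ P' : List ℕ, P'.length = d ∧ IsPathIn (keepAdj A M C W) (keepVerts n M C W) P' ∧
      ∀ v ∈ P', v ∉ S := by
  obtain ⟨hCH, hCF, hCC⟩ := core_spec (k := k) (M := M) hA hd
  rw [← hC] at hCH hCF hCC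
  have hMC : ∀ v, v < n → ¬ (v ∈ F ∧ v ∉ C) → v ∈ M ∨ v ∈ C := by
    intro v hv h
    rw [hF] at h
    tauto
  refine Exists.elim (exists_path_of_replace (A₁ := A)
    (A₂ := keepAdj A M C W) (N := fun v => v ∈ F ∧ v ∉ C)
    (T₁ := fun v => v < n ∧ v ∉ S)
    (T₂ := fun v => v ∈ keepVerts n M C W ∧ v ∉ S) (d := d)
    (fun _ _ h => (keepAdj_iff.1 h).1) (fun v hv => ⟨(mem_keepVerts.1 hv.1).1, hv.2⟩)
    (fun a b h ha hb hNa hNb =>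
      keepAdj_iff.2 ⟨h, Or.inl ⟨hMC a ha.1 hNa, hMC b hb.1 hNb⟩⟩)
    (fun v hv hN => ⟨mem_keepVerts.2 ⟨hv.1, by have := hMC v hv.1 hN; tauto⟩, hv.2⟩) ?hrep
    hPd hP.1 hP.2.1 (fun v hv => ⟨List.mem_range.1 (hP.2.2 hv), hPS v hv⟩)) ?main
  case main =>
    rintro P' ⟨p1, p2, p3, p4⟩
    exact ⟨P', p1, ⟨p2, p3, fun v hv => (p4 v hv).1⟩, fun v hv => (p4 v hv).2⟩
  intro L Q R e1 e2 e3 e4 hQ0 hQN hL hR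
  obtain ⟨q, hq⟩ : ∃ q, Q.head? = some q := by
    cases Q with
    | nil => exact absurd rfl hQ0
    | cons q Q => exact ⟨q, rfl⟩
  have hqQ := List.mem_of_mem_head? hq
  have hq' := List.getLast?_eq_some_getLast hQ0
  have hQF : Q ⊆ F := fun v hv => (hQN v hv).1
  set c := ancIn A d F C q with hcdef
  have hcF : c ⊆ F := fun v hv => (isPathIn_anc hA hd (hQF hqQ)).2.2 (List.mem_filter.1 hv).1
  have hcl : c.length ≤ d := length_ancIn_le A d F C q
  have hQc : Q ⊆ group A d F C c := by
    have hch := (List.isChain_append.1 (List.isChain_append.1 e3).2.1).1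
    have : ∀ Q : List ℕ, Q.IsChain (fun a b => A a b) → (∀ v ∈ Q, v ∈ F ∧ v ∉ C) →
        ∀ q, Q.head? = some q → ∀ v ∈ Q, ancIn A d F C v = ancIn A d F C q := by
      intro Q
      induction Q with
      | nil => simp
      | cons x Q ih =>
        intro hch hN q hq v hv
        obtain rfl : x = q := by simpa using hq
        rcases List.mem_cons.1 hv with rfl | hv
        · rfl
        · cases Q with
          | nil => cases hv
          | cons y Q =>
            rw [List.isChain_cons] at hch
            rw [ih hch.2 (fun v hv => hN v (List.mem_cons_of_mem _ hv)) y rfl v hv]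
            have h1 := hN x List.mem_cons_self
            have h2 := hN y (List.mem_cons_of_mem _ List.mem_cons_self)
            exact (ancIn_eq_of_adj hA hd hCC h1.1 h1.2 h2.1 h2.2 (hch.1 y rfl)).symm
    intro v hv
    exact mem_group.2 ⟨(hQN v hv).1, (hQN v hv).2, this Q hch hQN q hq v hv⟩
  have hgF : group A d F C c ⊆ F := fun v hv => (mem_group.1 hv).1
  have hseg := mem_segments_of_isChain e3 e2 e1 hQc
  obtain ⟨_, _, _, s4, s5⟩ := mem_segments.1 hseg
  have ha : ∀ x ∈ L.getLast?, x ∈ M ∨ x ∈ c := fun x hx => by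
    have hxT := e4 x (List.mem_append_left _ (List.mem_of_getLast? hx))
    rcases mem_of_adj_group hA hd hCC hF (hQc hqQ) hxT.1 (hA _ _ (s4 x hx q hq)) with h | h | h
    · exact Or.inl h
    · exact Or.inr h
    · exact absurd ⟨(mem_group.1 h).1, (mem_group.1 h).2.1⟩ (hL x hx)
  have hb : ∀ x ∈ R.head?, x ∈ M ∨ x ∈ c := fun x hx => by
    have hxT := e4 x (List.mem_append_right _ (List.mem_append_right _
      (List.mem_of_mem_head? hx)))
    rcases mem_of_adj_group hA hd hCC hF (hQc (List.getLast_mem hQ0)) hxT.1 (s5 _ hq' x hx)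
      with h | h | h
    · exact Or.inl h
    · exact Or.inr h
    · exact absurd ⟨(mem_group.1 h).1, (mem_group.1 h).2.1⟩ (hR x hx)
  have hlen : (L ++ R).length < d := by
    have h5 := List.length_pos_of_ne_nil hQ0
    simp only [List.length_append] at e1 ⊢
    omega
  have h4 := List.toFinset_card_le (L ++ R)
  obtain ⟨Q', hQ', hk, hQS, hQLR⟩ : ∃ Q' ∈ segments A d F L.getLast? R.head? Q.length,
      (∀ v ∈ Q', v ∈ C ∨ ((L.getLast?, v) ∈ W ∧ (R.head?, v) ∈ W)) ∧ (∀ v ∈ Q', v ∉ S) ∧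
      ∀ v ∈ Q', v ∉ (L ++ R).toFinset := by
    -- With both ends in `M` or absent the packings provide the replacement. Otherwise some end lies
    -- in `c`, and the representatives of the group provide it.
    by_cases hab : L.getLast? ∈ ends M ∧ R.head? ∈ ends M
    · obtain ⟨Q', hQ', hQH, hQZ⟩ := linkers_spec (K := k + 2 * d) hab.1 hab.2
        (segments_mono hgF hseg) hQ0 (fun v hv h => (hQN v hv).2 (hCH h))
        (Z := S ∪ (L ++ R).toFinset) (by
          have h1 := Finset.card_union_le S (L ++ R).toFinset
          omega)
      exact ⟨Q', hQ', fun v hv => Or.inl (hCH (hQH hv)),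
        fun v hv h => hQZ v hv (Finset.mem_union_left _ h),
        fun v hv h => hQZ v hv (Finset.mem_union_right _ h)⟩
    · have hge : (L.getLast?, R.head?) ∈ groupEnds M c := by
        have key : ∀ o : Option ℕ, (∀ x ∈ o, x ∈ M ∨ x ∈ c) → o ∈ ends M ∨ ∃ x ∈ o, x ∈ c := by
          intro o ho
          cases o with
          | none => exact Or.inl (mem_ends.2 (by simp))
          | some x =>
            rcases ho x rfl with h | h
            · exact Or.inl (mem_ends.2 (by simpa using h))
            · exact Or.inr ⟨x, rfl, h⟩
        have h1 := key _ ha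
        have h2 := key _ hb
        rw [mem_groupEnds]
        rcases h1 with h1' | h1'
        · exact Or.inl ⟨h2.resolve_left fun h => hab ⟨h1', h⟩, Or.inl h1'⟩
        · exact Or.inr ⟨h1', h2⟩
      have hne : c ≠ [] := by
        intro h0
        rw [mem_groupEnds, h0] at hge
        simp at hge
      obtain ⟨y, hy, hyc⟩ := exists_ancIn_eq_anc hA hd hCC (hQF hqQ) hne
      -- The representatives stay in the group, so only the part of `S` inside it matters. It has at
      -- most `d` vertices, and the rest of the path fewer than `d`, whence the budget `2 * d` in
      -- `groupMarks`.
      obtain ⟨Q', hQ', hQZ, hQW⟩ := groupMarks_spec hge hseg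
        (Z := S.filter (fun v => v ∈ group A d F C c) ∪ (L ++ R).toFinset) (by
          have h1 := Finset.card_union_le (S.filter (fun v => v ∈ group A d F C c))
            (L ++ R).toFinset
          have h2 := hS c hcl
          omega) (fun v hv h => by
          rw [Finset.mem_union, Finset.mem_filter, List.mem_toFinset] at h
          rcases h with h | h
          · exact (e4 v (List.mem_append_right _ (List.mem_append_left _ hv))).2 h.1
          · have n1 := List.nodup_append.1 e2
            rcases List.mem_append.1 h with h | h
            · exact n1.2.2 v h v (List.mem_append_left _ hv) rfl
            · exact (List.nodup_append.1 n1.2.1).2.2 v hv v h rfl)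
      have hsub : groupMarks A d M F C c ⊆ W := fun w hw => by
        rw [hW, marks]
        refine List.mem_flatMap.2 ⟨y, hy, ?_⟩
        rw [← hyc]
        exact hw
      refine ⟨Q', segments_mono hgF hQ', fun v hv => Or.inr ⟨hsub (hQW v hv).1, hsub (hQW v hv).2⟩,
        fun v hv h => ?_, fun v hv h => hQZ v hv (Finset.mem_union_right _ h)⟩
      exact hQZ v hv (Finset.mem_union_left _ (Finset.mem_filter.2
        ⟨h, (mem_segments.1 hQ').2.1.2.2 hv⟩))
  obtain ⟨k1, k2, k3, k4⟩ := kept_segment (W := W) (C := C) hA hF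
    (fun x hx => (ha x hx).imp_right fun h => hcF h) (fun x hx => (hb x hx).imp_right fun h => hcF h)
    hQ' hk
  obtain ⟨_, t2, t3, _⟩ := mem_segments.1 hQ'
  refine ⟨Q', t3, t2.1, k1, fun v hv => ⟨k2 hv, hQS v hv⟩, fun v hv => ?_, k3, k4⟩
  have := hQLR v hv
  simp only [List.mem_toFinset, List.mem_append] at this
  tauto

/-- From a solution of the kernel pass to a minimum one. By `exchange`, trading its vertices in a
group for `c` gives another solution, so it has at most `|c|` vertices there, as
`cover_of_kernel_cover` requires. The converse holds because the kernel is a subgraph. -/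
theorem hasCover_kernel_iff (hA : ∀ a b, A a b → A b a) (hF : ∀ v, v ∈ F ↔ v < n ∧ v ∉ M)
    (hd : ∀ p, IsPathIn A F p → p.length < d) (hC : C = core A d k M F)
    (hW : W = marks A d M F C) :
    HasCover (keepAdj A M C W) (keepVerts n M C W) d k ↔ HasCover A (List.range n) d k := by
  constructor
  · rintro ⟨S₀, hS₀k, hS₀⟩
    obtain ⟨S, hS, hmin⟩ := WellFounded.has_min (measure (Finset.card (α := ℕ))).wf
      {S | ∀ P : List ℕ, P.length = d → IsPathIn (keepAdj A M C W) (keepVerts n M C W) P →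
        ∃ v ∈ P, v ∈ S} ⟨S₀, hS₀⟩
    have hmin' : ∀ S' : Finset ℕ, (∀ P : List ℕ, P.length = d →
        IsPathIn (keepAdj A M C W) (keepVerts n M C W) P → ∃ v ∈ P, v ∈ S') → S.card ≤ S'.card :=
      fun S' hS' => not_lt.1 (hmin S' hS')
    have hSk : S.card ≤ k := (hmin' S₀ hS₀).trans hS₀k
    refine ⟨S, hSk, fun P hPd hP => ?_⟩
    by_contra hPS
    push Not at hPS
    obtain ⟨P', h1, h2, h3⟩ := cover_of_kernel_cover hA hF hd hC hW hSk (fun c hc => by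
      have h1 := hmin' _ (exchange hA hF hd hC hSk hS hc)
      have h2 := Finset.card_union_le (S.filter fun v => v ∉ group A d F C c) c.toFinset
      have h3 := List.toFinset_card_le c
      have h4 := Finset.card_filter_add_card_filter_not (s := S) fun v => v ∈ group A d F C c
      omega) hPd hP hPS
    obtain ⟨v, hv, hvS⟩ := hS P' h1 h2
    exact h3 v hv hvS
  · rintro ⟨S, hSk, hS⟩
    refine ⟨S, hSk, fun P hPd hP => hS P hPd ⟨hP.1, hP.2.1.imp fun a b h => (keepAdj_iff.1 h).1,
      fun v hv => List.mem_range.2 (mem_keepVerts.1 (hP.2.2 hv)).1⟩⟩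

end

/-! ### Size of the kernel -/

section
variable {A : ℕ → ℕ → Bool} {d k l n κ : ℕ} {M F C c : List ℕ} {a b : Option ℕ}
  {W : List (Option ℕ × ℕ)}

theorem length_ends : (ends M).length = M.length + 1 := by simp [ends]

/-- There are at most `2dκ` choices for either end, `2d` lengths, `3dκ` packed segments for each,
and `d` vertices per segment. -/
theorem length_linkers_le {K : ℕ} (hd : 1 ≤ d) (hκ : 1 ≤ κ) (hM : M.length ≤ d * κ)
    (hK : K ≤ 3 * d * κ) : (linkers A d K M F).length ≤ 24 * d ^ 5 * κ ^ 3 := by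
  have h1 : ∀ a b : Option ℕ, ∀ l,
      (pack K (segments A d F a b l)).flatten.length ≤ 3 * d * κ * d := fun a b l =>
    (length_flatten_le fun Q hQ => (mem_segments.1 ((pack_spec _ _).1 hQ)).1).trans
      (Nat.mul_le_mul_right d ((pack_spec _ _).2.1.trans hK))
  have he : (ends M).length ≤ 2 * d * κ := by
    have := Nat.mul_pos hd hκ
    rw [length_ends]; nlinarith
  have hr : (List.range (d + 1)).length ≤ 2 * d := by rw [List.length_range]; omega
  have h2 : ∀ a b, ((List.range (d + 1)).flatMap fun l =>
      (pack K (segments A d F a b l)).flatten).length ≤ 2 * d * (3 * d * κ * d) := fun a b =>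
    (length_flatMap_le fun l _ => h1 a b l).trans (Nat.mul_le_mul_right _ hr)
  have h3 : ∀ a, ((ends M).flatMap fun b => (List.range (d + 1)).flatMap fun l =>
      (pack K (segments A d F a b l)).flatten).length ≤
        2 * d * κ * (2 * d * (3 * d * κ * d)) := fun a =>
    (length_flatMap_le fun b _ => h2 a b).trans (Nat.mul_le_mul_right _ he)
  refine ((length_flatMap_le fun a _ => h3 a).trans (Nat.mul_le_mul_right _ he)).trans
    (le_of_eq ?_)
  ring

theorem length_core_le (hd : 1 ≤ d) (hκ : 1 ≤ κ) (hk : k ≤ κ) (hM : M.length ≤ d * κ) :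
    (core A d k M F).length ≤ 24 * d ^ 6 * κ ^ 3 := by
  have h1 := length_linkers_le (A := A) (F := F) (K := k + 2 * d) hd hκ hM (by nlinarith)
  have h2 := length_flatMap_le (l := linkers A d (k + 2 * d) M F)
    fun v _ => length_anc_le A d F v
  refine (h2.trans (Nat.mul_le_mul_right _ h1)).trans (le_of_eq ?_)
  ring

/-- There are at most `6d²κ` pairs of ends, as one end lies in `c`; then `2d` lengths, `3d · d^(2d)`
representatives with `d` vertices each, and two marks per vertex. -/
theorem length_groupMarks_le (hd : 1 ≤ d) (hκ : 1 ≤ κ) (hM : M.length ≤ d * κ)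
    (hc : c.length ≤ d) :
    (groupMarks A d M F C c).length ≤ 72 * d ^ 5 * κ * d ^ (2 * d) := by
  have h1 : (groupEnds M c).length ≤ 6 * d ^ 2 * κ := by
    have h2 : (ends M ++ c.map fun x => some x).length ≤ 3 * d * κ := by
      rw [List.length_append, length_ends, List.length_map]
      nlinarith [Nat.mul_le_mul hd hκ]
    refine ((length_flatMap_le fun b _ => (length_flatMap_le (b := 2) fun o _ => by simp).trans
      (Nat.mul_le_mul_right 2 h2)).trans (Nat.mul_le_mul_right _ hc)).trans (le_of_eq ?_)
    ring
  have h3 : ∀ a b l, (rep (2 * d) (segments A d (group A d F C c) a b l)).flatten.length ≤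
      3 * d * d ^ (2 * d) * d := fun a b l => by
    have h4 := length_rep_le hd (2 * d) (fam := segments A d (group A d F C c) a b l)
      fun Q hQ => (mem_segments.1 hQ).1
    refine (length_flatten_le fun Q hQ => (mem_segments.1 (rep_subset _ _ hQ)).1).trans
      (Nat.mul_le_mul_right d (h4.trans (Nat.mul_le_mul_right _ ?_)))
    omega
  have hr : (List.range (d + 1)).length ≤ 2 * d := by rw [List.length_range]; omega
  refine ((length_flatMap_le fun o _ => (length_flatMap_le fun l _ =>
    (length_flatMap_le (b := 2) fun v _ => by simp).trans
    (Nat.mul_le_mul_right 2 (h3 o.1 o.2 l))).trans (Nat.mul_le_mul_right _ hr)).trans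
    (Nat.mul_le_mul_right _ h1)).trans (le_of_eq ?_)
  ring

theorem length_marks_le (hd : 1 ≤ d) (hκ : 1 ≤ κ) (hM : M.length ≤ d * κ)
    (hC : C.length ≤ 24 * d ^ 6 * κ ^ 3) :
    (marks A d M F C).length ≤ 1728 * κ ^ 4 * d ^ (2 * d + 11) := by
  refine ((length_flatMap_le fun a _ => length_groupMarks_le hd hκ hM
    (length_anc_le A d F a)).trans (Nat.mul_le_mul_right _ hC)).trans (le_of_eq ?_)
  ring

theorem nodup_keepVerts : (keepVerts n M C W).Nodup := List.nodup_range.filter _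

theorem length_keepVerts_le :
    (keepVerts n M C W).length ≤ M.length + C.length + W.length := by
  have h : keepVerts n M C W ⊆ M ++ C ++ W.map fun w => w.2 := by
    intro v hv
    rw [mem_keepVerts] at hv
    simp only [List.mem_append, List.mem_map, Prod.exists, exists_eq_right]
    tauto
  simpa [add_assoc] using (nodup_keepVerts.subperm h).length_le

/-- A list that contains every edge of the kernel in one of its directions. -/
def edgeList (A : ℕ → ℕ → Bool) (d n : ℕ) (M F C : List ℕ) (W : List (Option ℕ × ℕ)) :
    List (ℕ × ℕ) :=
  (M.flatMap fun u => (M ++ C).map fun v => (u, v)) ++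
    ((keepVerts n M C W).flatMap fun v => (anc A d F v).map fun u => (u, v)) ++
    W.flatMap fun w => w.1.toList.map fun u => (u, w.2)

/-- An edge outside `M` joins a vertex to one of its ancestors. An edge at `M` leads to `M`, to `C`
or to a marked vertex. -/
theorem mem_edgeList (hA : ∀ a b, A a b → A b a) (hF : ∀ v, v ∈ F ↔ v < n ∧ v ∉ M)
    (hd : ∀ p, IsPathIn A F p → p.length < d) {u v : ℕ}
    (hu : u ∈ keepVerts n M C W) (hv : v ∈ keepVerts n M C W) (h : keepAdj A M C W u v) :
    (u, v) ∈ edgeList A d n M F C W ∨ (v, u) ∈ edgeList A d n M F C W := by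
  rw [keepAdj_iff] at h
  have hun := (mem_keepVerts.1 hu).1
  have hvn := (mem_keepVerts.1 hv).1
  have hFF : u ∉ M → v ∉ M →
      (u, v) ∈ edgeList A d n M F C W ∨ (v, u) ∈ edgeList A d n M F C W := by
    intro h1 h2
    refine (mem_anc_of_adj hA hd ((hF u).2 ⟨hun, h1⟩) ((hF v).2 ⟨hvn, h2⟩) h.1).imp
      (fun h => ?_) fun h => ?_
    · exact List.mem_append_left _ (List.mem_append_right _ (List.mem_flatMap.2
        ⟨v, hv, List.mem_map.2 ⟨u, h, rfl⟩⟩))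
    · exact List.mem_append_left _ (List.mem_append_right _ (List.mem_flatMap.2
        ⟨u, hu, List.mem_map.2 ⟨v, h, rfl⟩⟩))
  have hMC : ∀ u v, u ∈ M → (v ∈ M ∨ v ∈ C) → (u, v) ∈ edgeList A d n M F C W := fun u v h1 h2 =>
    List.mem_append_left _ (List.mem_append_left _ (List.mem_flatMap.2
      ⟨u, h1, List.mem_map.2 ⟨v, List.mem_append.2 h2, rfl⟩⟩))
  have hWW : ∀ u v, (some u, v) ∈ W → (u, v) ∈ edgeList A d n M F C W := fun u v h1 =>
    List.mem_append_right _ (List.mem_flatMap.2 ⟨_, h1, by simp⟩)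
  by_cases h1 : u ∈ M
  · rcases h.2 with h | h | h | h
    · exact Or.inl (hMC u v h1 h.2)
    · exact absurd h1 h.1
    · exact Or.inl (hWW u v h)
    · exact Or.inr (hWW v u h)
  by_cases h2 : v ∈ M
  · rcases h.2 with h | h | h | h
    · exact Or.inr (hMC v u h2 h.1)
    · exact absurd h2 h.2
    · exact Or.inl (hWW u v h)
    · exact Or.inr (hWW v u h)
  exact hFF h1 h2

theorem length_edgeList_le :
    (edgeList A d n M F C W).length ≤ M.length * (M.length + C.length) +
      (keepVerts n M C W).length * d + W.length := by
  simp only [edgeList, List.length_append]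
  refine Nat.add_le_add (Nat.add_le_add ?_ ?_) ?_
  · exact length_flatMap_le fun u _ => by simp
  · exact length_flatMap_le fun v _ => by rw [List.length_map]; exact length_anc_le A d F v
  · refine (length_flatMap_le (b := 1) fun w _ => ?_).trans (by omega)
    cases w.1 <;> simp

theorem kernel_size_le (hd : 1 ≤ d) (hκ : 1 ≤ κ) (hk : k ≤ κ) (hM : M.length ≤ d * κ)
    (hC : C = core A d k M F) (hW : W = marks A d M F C) :
    (keepVerts n M C W).length ≤ 4000 * κ ^ 4 * d ^ (4000 * d) ∧
      (edgeList A d n M F C W).length ≤ 4000 * κ ^ 4 * d ^ (4000 * d) := by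
  have h1 : C.length ≤ 24 * d ^ 6 * κ ^ 3 := hC ▸ length_core_le hd hκ hk hM
  have h2 : W.length ≤ 1728 * κ ^ 4 * d ^ (2 * d + 11) := hW ▸ length_marks_le hd hκ hM h1
  have h3 := length_keepVerts_le (n := n) (M := M) (C := C) (W := W)
  have h4 := length_edgeList_le (A := A) (d := d) (n := n) (M := M) (F := F) (C := C) (W := W)
  have hdp : ∀ {i j : ℕ}, i ≤ j → d ^ i ≤ d ^ j := fun h => Nat.pow_le_pow_right hd h
  have hκp : ∀ {i j : ℕ}, i ≤ j → κ ^ i ≤ κ ^ j := fun h => Nat.pow_le_pow_right hκ h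
  -- Every contribution is compared with the one monomial `κ ^ 4 * d ^ (2 * d + 12)`. The
  -- coefficients add up to 1753 for vertices and 25 + 1753 + 1728 for edges, both below 4000.
  have key : ∀ i j, i ≤ 4 → j ≤ 2 * d + 12 → κ ^ i * d ^ j ≤ κ ^ 4 * d ^ (2 * d + 12) :=
    fun i j hi hj => Nat.mul_le_mul (hκp hi) (hdp hj)
  have e1 : M.length ≤ κ ^ 4 * d ^ (2 * d + 12) := by
    refine hM.trans ((le_of_eq ?_).trans (key 1 1 (by omega) (by omega)))
    ring
  have e2 : C.length ≤ 24 * (κ ^ 4 * d ^ (2 * d + 12)) := by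
    refine h1.trans ((le_of_eq ?_).trans (Nat.mul_le_mul_left 24 (key 3 6 (by omega) (by omega))))
    ring
  have e3 : W.length ≤ 1728 * (κ ^ 4 * d ^ (2 * d + 12)) := by
    refine h2.trans ((le_of_eq ?_).trans
      (Nat.mul_le_mul_left 1728 (key 4 (2 * d + 11) (by omega) (by omega))))
    ring
  have e4 : M.length * (M.length + C.length) ≤ 25 * (κ ^ 4 * d ^ (2 * d + 12)) := by
    have h5 : M.length + C.length ≤ 25 * d ^ 6 * κ ^ 3 := by
      have : d * κ ≤ d ^ 6 * κ ^ 3 := Nat.mul_le_mul (by simpa using hdp (show 1 ≤ 6 by omega))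
        (by simpa using hκp (show 1 ≤ 3 by omega))
      nlinarith
    refine (Nat.mul_le_mul hM h5).trans ((le_of_eq ?_).trans
      (Nat.mul_le_mul_left 25 (key 4 7 (by omega) (by omega))))
    ring
  have e5 : (keepVerts n M C W).length * d ≤ 1753 * (κ ^ 4 * d ^ (2 * d + 12)) := by
    have h5 : (keepVerts n M C W).length ≤ 1753 * (κ ^ 4 * d ^ (2 * d + 11)) := by
      have h6 : d * κ ≤ κ ^ 4 * d ^ (2 * d + 11) := by
        rw [mul_comm]
        exact Nat.mul_le_mul (by simpa using hκp (show 1 ≤ 4 by omega))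
          (by simpa using hdp (show 1 ≤ 2 * d + 11 by omega))
      have h7 : d ^ 6 * κ ^ 3 ≤ κ ^ 4 * d ^ (2 * d + 11) := by
        rw [mul_comm]
        exact Nat.mul_le_mul (hκp (by omega)) (hdp (by omega))
      nlinarith
    refine (Nat.mul_le_mul_right d h5).trans (le_of_eq ?_)
    ring
  have e6 : κ ^ 4 * d ^ (2 * d + 12) ≤ κ ^ 4 * d ^ (4000 * d) :=
    Nat.mul_le_mul_left _ (hdp (by omega))
  rw [mul_assoc]
  constructor <;> omega

end

/-! ### Translation between graphs and lists -/

theorem exists_path_iff_isContained {n d : ℕ} (G : SimpleGraph (Fin n)) (s : Set (Fin n)) :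
    (SimpleGraph.pathGraph d).IsContained (G.induce s) ↔
      ∃ P : List (Fin n), P.length = d ∧ P.Nodup ∧ P.IsChain G.Adj ∧ ∀ v ∈ P, v ∈ s := by
  constructor
  · rintro ⟨φ⟩
    refine ⟨List.ofFn fun i => (φ i : Fin n), List.length_ofFn, ?_, ?_, ?_⟩
    · exact List.nodup_ofFn.2 (Subtype.val_injective.comp φ.injective)
    · rw [List.isChain_iff_getElem]
      intro i hi
      rw [List.length_ofFn] at hi
      have h : (SimpleGraph.pathGraph d).Adj ⟨i, by omega⟩ ⟨i + 1, hi⟩ :=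
        SimpleGraph.pathGraph_adj.2 (Or.inl rfl)
      simpa using φ.toHom.map_adj h
    · intro v hv
      obtain ⟨i, rfl⟩ := List.mem_ofFn.1 hv
      exact (φ i).2
  · rintro ⟨P, rfl, h2, h3, h4⟩
    rw [List.isChain_iff_getElem] at h3
    refine ⟨⟨⟨fun i => ⟨P[i], h4 _ (List.getElem_mem _)⟩, ?_⟩, ?_⟩⟩
    · intro i j hij
      rcases SimpleGraph.pathGraph_adj.1 hij with h | h
      · have := h3 i (by omega)
        simpa [h] using this
      · have := h3 j (by omega)
        simpa [h] using this.symm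
    · intro i j hij
      exact Fin.ext ((h2.getElem_inj_iff).1 (Subtype.ext_iff.1 hij))

/-- Path vertex covers in terms of lists of vertices. -/
theorem hasPathVertexCover_iff {n d k : ℕ} (G : SimpleGraph (Fin n)) (f : Fin n → ℕ)
    (hf : Function.Injective f) (A : ℕ → ℕ → Bool) (hA : ∀ i j, G.Adj i j ↔ A (f i) (f j))
    (V : List ℕ) (hV : ∀ v, v ∈ V ↔ ∃ i, f i = v) :
    HasPathVertexCover d G k ↔ HasCover A V d k := by
  constructor
  · rintro ⟨S, hSk, hS⟩
    refine ⟨S.image f, Finset.card_image_le.trans hSk, fun P hPd hP => ?_⟩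
    by_contra hPS
    push Not at hPS
    refine hS ((exists_path_iff_isContained _ _).2 ?_)
    obtain ⟨P', rfl⟩ : P ∈ Set.range (List.map f) := by
      rw [Set.range_list_map]
      exact fun v hv => (hV v).1 (hP.2.2 hv)
    refine ⟨P', by simpa using hPd, hP.1.of_map f, ?_, fun v hv hvS => ?_⟩
    · exact ((List.isChain_map f).1 hP.2.1).imp fun a b h => (hA a b).2 h
    · exact hPS _ (List.mem_map_of_mem hv) (Finset.mem_image_of_mem f hvS)
  · rintro ⟨S, hSk, hS⟩
    refine ⟨Finset.univ.filter fun i => f i ∈ S, ?_, fun hcon => ?_⟩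
    · exact (Finset.card_le_card_of_injOn f (fun i hi => (Finset.mem_filter.1 hi).2)
        hf.injOn).trans hSk
    · obtain ⟨P, h1, h2, h3, h4⟩ := (exists_path_iff_isContained _ _).1 hcon
      obtain ⟨v, hv, hvS⟩ := hS (P.map f) (by simpa using h1) ⟨h2.map hf,
        (List.isChain_map f).2 (h3.imp fun a b h => (hA a b).1 h),
        fun v hv => by
          obtain ⟨i, _, rfl⟩ := List.mem_map.1 hv
          exact (hV _).2 ⟨i, rfl⟩⟩
      obtain ⟨i, hi, rfl⟩ := List.mem_map.1 hv
      exact h4 i hi (Finset.mem_filter.2 ⟨Finset.mem_univ _, hvS⟩)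

theorem ncard_edgeSet_le {n : ℕ} (G : SimpleGraph (Fin n)) (f : Fin n → ℕ)
    (hf : Function.Injective f) (E : List (ℕ × ℕ))
    (h : ∀ i j, G.Adj i j → (f i, f j) ∈ E ∨ (f j, f i) ∈ E) : G.edgeSet.ncard ≤ E.length := by
  classical
  have h1 : (G.edgeSet.image (Sym2.map f)).ncard = G.edgeSet.ncard :=
    Set.ncard_image_of_injective _ (Sym2.map.injective hf)
  have h2 : G.edgeSet.image (Sym2.map f) ⊆ ((E.map fun e => s(e.1, e.2)).toFinset : Set (Sym2 ℕ)) := by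
    rintro _ ⟨e, he, rfl⟩
    induction e with
    | _ i j =>
      rw [SimpleGraph.mem_edgeSet] at he
      rw [Finset.mem_coe, List.mem_toFinset, List.mem_map, Sym2.map_mk]
      rcases h i j he with h | h
      · exact ⟨_, h, rfl⟩
      · exact ⟨_, h, Sym2.eq_swap⟩
  rw [← h1]
  refine (Set.ncard_le_ncard h2 (Finset.finite_toSet _)).trans ?_
  rw [Set.ncard_coe_finset]
  exact (List.toFinset_card_le _).trans (by simp)

open Classical in
/-- The adjacency matrix of a graph. -/
noncomputable def matrixOf {n : ℕ} (G : SimpleGraph (Fin n)) : List (List Bool) :=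
  List.ofFn fun i => List.ofFn fun j => decide (G.Adj i j)

theorem enc_matrixOf {n : ℕ} (G : SimpleGraph (Fin n)) (k : ℕ) :
    enc (matrixOf G, k) = Data.ofInstance G k := by
  have h : enc (matrixOf G) = Data.ofList ((matrixOf G).map fun r => Data.ofList (r.map enc)) := rfl
  have h' : enc (matrixOf G, k) = Data.cons (enc (matrixOf G)) (Data.ofNat k) := rfl
  rw [h', h, matrixOf, List.map_ofFn, Data.ofInstance]
  congr 3
  funext i
  simp only [Function.comp, List.map_ofFn]
  rfl

theorem length_matrixOf {n : ℕ} (G : SimpleGraph (Fin n)) : (matrixOf G).length = n :=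
  List.length_ofFn

theorem adjOf_matrixOf {n : ℕ} (G : SimpleGraph (Fin n)) (u v : ℕ) :
    adjOf (matrixOf G) u v ↔ ∃ i j : Fin n, i.val = u ∧ j.val = v ∧ G.Adj i j := by
  rw [adjOf, matrixOf]
  by_cases hu : u < n
  · by_cases hv : v < n
    · simp only [List.getD_eq_getElem?_getD, List.getElem?_ofFn, hu, hv, dite_true,
        Option.getD_some, decide_eq_true_iff]
      exact ⟨fun h => ⟨_, _, rfl, rfl, h⟩, by rintro ⟨i, j, rfl, rfl, h⟩; exact h⟩
    · simp only [List.getD_eq_getElem?_getD, List.getElem?_ofFn, hu, hv, dite_true, dite_false,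
        Option.getD_some, Option.getD_none]
      exact ⟨by simp, by rintro ⟨i, j, rfl, rfl, h⟩; exact absurd j.2 hv⟩
  · simp only [List.getD_eq_getElem?_getD, List.getElem?_ofFn, hu, dite_false,
      Option.getD_none, List.getElem?_nil]
    exact ⟨by simp, by rintro ⟨i, j, rfl, rfl, h⟩; exact absurd i.2 hu⟩

/-- A symmetric irreflexive relation gives a graph on the positions of a list. -/
theorem exists_graph (A : ℕ → ℕ → Bool) (hs : ∀ u v, A u v → A v u) (hl : ∀ u, ¬ A u u)
    (R : List ℕ) : ∃ G : SimpleGraph (Fin R.length), (∀ i j, G.Adj i j ↔ A R[i] R[j]) ∧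
      matrixOf G = R.map fun u => R.map fun v => A u v := by
  refine ⟨⟨fun i j => A R[i] R[j], ⟨fun i j h => hs _ _ h⟩, ⟨fun i h => hl _ h⟩⟩, fun i j => Iff.rfl, ?_⟩
  have : ∀ {β : Type} (g : ℕ → β), R.map g = List.ofFn fun i : Fin R.length => g R[i] :=
    fun g => by
      apply List.ext_getElem
      · simp
      · intro i h1 h2; simp
  rw [matrixOf, this]
  congr 1
  funext i
  rw [this]
  congr 1
  funext j
  simp

section
variable {A : ℕ → ℕ → Bool} {d k n : ℕ}

/-- The packing stopped short of `k + 1` members, so it is maximal. A longer path in the rest would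
have an initial part on exactly `d` vertices disjoint from it. -/
theorem length_lt_of_pack (hd : 1 ≤ d)
    (hp : (pack (k + 1) (pathsOf A (List.range n) d)).length ≤ k) {p : List ℕ}
    (h : IsPathIn A (without (List.range n) (modulator A d k n)) p) : p.length < d := by
  by_contra hlt
  have hsub := List.take_sublist d p
  have hlen : (p.take d).length = d := by rw [List.length_take]; omega
  obtain ⟨v, hv, hvM⟩ := (pack_spec (k + 1) (pathsOf A (List.range n) d)).2.2.2 (by omega)
    (p.take d) (mem_pathsOf.2 ⟨hlen, h.1.sublist hsub, h.2.1.take d,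
      fun v hv => (mem_without.1 (h.2.2 (hsub.subset hv))).1⟩)
    (by rintro h0; rw [h0] at hlen; simp at hlen; omega)
  exact (mem_without.1 (h.2.2 (hsub.subset hv))).2 hvM

theorem not_hasCover_of_pack
    (hp : k < (pack (k + 1) (pathsOf A (List.range n) d)).length) :
    ¬ HasCover A (List.range n) d k := by
  rintro ⟨S, hSk, hS⟩
  obtain ⟨h1, _, h3, _⟩ := pack_spec (k + 1) (pathsOf A (List.range n) d)
  obtain ⟨Q, hQ, hQS⟩ := exists_disjoint_of_card_lt h3 S (by omega)
  have hQ' := mem_pathsOf.1 (h1 hQ)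
  obtain ⟨v, hv, hvS⟩ := hS Q hQ'.1 hQ'.2
  exact hQS v hv hvS

theorem length_modulator_le (hp : (pack (k + 1) (pathsOf A (List.range n) d)).length ≤ k) :
    (modulator A d k n).length ≤ d * k := by
  rw [mul_comm]
  exact (length_flatten_le fun Q hQ => (mem_pathsOf.1 ((pack_spec _ _).1 hQ)).1.le).trans
    (Nat.mul_le_mul_right d hp)

end

theorem not_hasPathVertexCover_pathGraph (d : ℕ) :
    ¬ HasPathVertexCover d (SimpleGraph.pathGraph d) 0 := by
  rintro ⟨S, hS, h⟩
  obtain rfl := Finset.card_eq_zero.1 (Nat.le_zero.1 hS)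
  exact h ⟨⟨⟨fun i => ⟨i, by simp⟩, fun h => h⟩, fun i j hij => Subtype.ext_iff.1 hij⟩⟩

end PathCover

/-! ### The kernelization theorem -/

open PathCover in
theorem mainTheorem3 :
    ∃ C : ℕ, ∀ d : ℕ, 1 ≤ d →
      AdmitsKernel (fun _ G k => HasPathVertexCover d G k)
        (fun k => C * max k 1 ^ 4 * d ^ (C * d))
        (fun k => C * max k 1 ^ 4 * d ^ (C * d)) := by
  refine ⟨4000, fun d hd => ?_⟩
  -- The path on `d` vertices with budget `0` serves as the fixed no-instance.
  obtain ⟨p, q, hpq⟩ := PolyTime.kernelize d (matrixOf (SimpleGraph.pathGraph d), 0)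
  refine ⟨p, q, fun n G k => ?_⟩
  obtain ⟨t, ht, htq⟩ := hpq (matrixOf G, k)
  rw [enc_matrixOf] at ht
  rw [esize, enc_matrixOf] at htq
  have hadj := adjOf_matrixOf G
  have hs : ∀ u v, adjOf (matrixOf G) u v → adjOf (matrixOf G) v u := by
    intro u v h
    obtain ⟨i, j, hi, hj, h⟩ := (hadj u v).1 h
    exact (hadj v u).2 ⟨j, i, hj, hi, h.symm⟩
  have hl : ∀ u, ¬ adjOf (matrixOf G) u u := by
    intro u h
    obtain ⟨i, j, hi, hj, h⟩ := (hadj u u).1 h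
    exact h.ne (Fin.ext (hi.trans hj.symm))
  have hG : HasPathVertexCover d G k ↔ HasCover (adjOf (matrixOf G)) (List.range n) d k := by
    refine hasPathVertexCover_iff G Fin.val Fin.val_injective _ (fun i j => ?_) _ fun v => ?_
    · rw [hadj]
      exact ⟨fun h => ⟨i, j, rfl, rfl, h⟩, by
        rintro ⟨a, b, ha, hb, h⟩; rwa [← Fin.ext ha, ← Fin.ext hb]⟩
    · rw [List.mem_range]
      exact ⟨fun h => ⟨⟨v, h⟩, rfl⟩, by rintro ⟨i, rfl⟩; exact i.2⟩
  rw [kernelize] at ht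
  simp only [length_matrixOf] at ht
  by_cases hp : (pack (k + 1) (pathsOf (adjOf (matrixOf G)) (List.range n) d)).length ≤ k
  · rw [decide_eq_true hp, cond_true] at ht
    have hdF : ∀ p, IsPathIn (adjOf (matrixOf G))
        (without (List.range n) (modulator (adjOf (matrixOf G)) d k n)) p → p.length < d :=
      fun p => length_lt_of_pack hd hp
    -- The size estimates use `κ = max k 1`, which is positive even for `k = 0`.
    have hMl := (length_modulator_le hp).trans (Nat.mul_le_mul_left d (le_max_left k 1))
    rw [kernelFor, keepMatrix] at ht
    generalize modulator (adjOf (matrixOf G)) d k n = M at *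
    have hF : ∀ v, v ∈ without (List.range n) M ↔ v < n ∧ v ∉ M := fun v => by
      rw [mem_without, List.mem_range]
    generalize without (List.range n) M = F at *
    obtain ⟨C, hC⟩ : ∃ C, C = core (adjOf (matrixOf G)) d k M F := ⟨_, rfl⟩
    rw [← hC] at ht
    obtain ⟨W, hW⟩ : ∃ W, W = marks (adjOf (matrixOf G)) d M F C := ⟨_, rfl⟩
    rw [← hW] at ht
    obtain ⟨hk1, hk2⟩ := kernel_size_le (n := n) hd (le_max_right k 1) (le_max_left k 1) hMl hC hW
    have hs' : ∀ u v, keepAdj (adjOf (matrixOf G)) M C W u v →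
        keepAdj (adjOf (matrixOf G)) M C W v u := by
      intro u v h
      rw [keepAdj_iff] at h ⊢
      exact ⟨hs _ _ h.1, by tauto⟩
    obtain ⟨G', hG', hT⟩ := exists_graph (keepAdj (adjOf (matrixOf G)) M C W) hs'
      (fun u h => hl u (keepAdj_iff.1 h).1) (keepVerts n M C W)
    rw [← hT, enc_matrixOf] at ht
    have hinj : Function.Injective fun i : Fin (keepVerts n M C W).length =>
        (keepVerts n M C W)[i] :=
      fun i j hij => Fin.ext (nodup_keepVerts.getElem_inj_iff.1 hij)
    refine ⟨_, G', k, t, ht, htq, ?_, le_rfl, hk1, ?_⟩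
    · change HasPathVertexCover d G' k ↔ HasPathVertexCover d G k
      rw [hG, ← hasCover_kernel_iff hs hF hdF hC hW]
      refine hasPathVertexCover_iff G' _ hinj _ hG' _ fun v => ?_
      rw [List.mem_iff_getElem]
      exact ⟨fun ⟨i, hi, h⟩ => ⟨⟨i, hi⟩, h⟩, fun ⟨i, h⟩ => ⟨i, i.2, h⟩⟩
    · refine (ncard_edgeSet_le G' _ hinj _ fun i j hij => ?_).trans hk2
      exact mem_edgeList hs hF hdF (List.getElem_mem _) (List.getElem_mem _) ((hG' i j).1 hij)
  · rw [decide_eq_false hp, cond_false, enc_matrixOf] at ht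
    -- The no-instance has `d` vertices, and its edges are among the `d * d` ordered pairs.
    have hb : d * d ≤ 4000 * max k 1 ^ 4 * d ^ (4000 * d) := by
      rw [← pow_two]
      calc d ^ 2 ≤ d ^ (4000 * d) := Nat.pow_le_pow_right hd (by omega)
        _ ≤ _ := Nat.le_mul_of_pos_left _ (by positivity)
    refine ⟨d, SimpleGraph.pathGraph d, 0, t, ht, htq, ?_, Nat.zero_le _,
      (Nat.le_mul_of_pos_left d hd).trans hb, ?_⟩
    · change HasPathVertexCover d _ 0 ↔ HasPathVertexCover d G k
      rw [hG]
      exact iff_of_false (not_hasPathVertexCover_pathGraph d) (not_hasCover_of_pack (not_le.1 hp))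
    · refine (ncard_edgeSet_le _ Fin.val Fin.val_injective
        ((List.range d).flatMap fun u => (List.range d).map fun v => (u, v)) fun i j _ => Or.inl ?_).trans
        (le_trans ?_ hb)
      · simp
      · refine (length_flatMap_le (b := d) fun u _ => by simp).trans (by simp)
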